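/- Let $H$ be a Hopf algebra with invertible antipode $S$ over a field $k$ of characteristic $0$, with $\Delta(h)=h^1\otimes h^2$, and let $\mathcal{M}^H$ be the monoidal category of right $H$-comodules, with coactions written $m\mapsto m_0\otimes m_1$. It is biclosed: for comodules $W,V$ let $\mathrm{Hom}^l(W,V)$ (resp. $\mathrm{Hom}^r(W,V)$) be the space of linear maps $f:W\to V$ such that $\rho^l f(w)=f(w_0)_0\otimes f(w_0)_1S(w_1)$ (resp. $\rho^r f(w)=f(w_0)_0\otimes S^{-1}(w_1)f(w_0)_1$) lies in $\mathrm{Hom}(W,V)\otimes H\subset \mathrm{Hom}(W,V\otimes H)$, with coaction $\rho^l$ (resp. $\rho^r$). Put $W\triangleright V=\mathrm{Hom}^l(W,V)$ and $V\triangleleft W=\mathrm{Hom}^r(W,V)$. Let $\mathcal{Z}$ be the center of the resulting opposite bimodule category: its objects are comodules $M$ with isomorphisms of comodules $\tau_W:W\triangleright M\to M\triangleleft W$, natural in $W\in\mathcal{M}^H$, such that $\tau_k$ is the canonical isomorphism $k\triangleright M\simeq M\simeq M\triangleleft k$ and $\tau_{W\otimes V}$ is the composite $$(W\otimes V)\triangleright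 M\simeq W\triangleright (V\triangleright M)\to W\triangleright(M\triangleleft V)\simeq (W\triangleright M)\triangleleft V\to (M\triangleleft W)\triangleleft V\simeq M\triangleleft(W\otimes V)$$ induced by $\tau_V$ and $\tau_W$; its morphisms are the comodule maps that commute with the $\tau_W$. Let $\mathcal{Z}'\subset\mathcal{Z}$ be the full subcategory of those objects for which $\mathrm{Id}_M$ is sent to itself by $$\mathrm{Hom}(M,M)^H\simeq \mathrm{Hom}(k,M\triangleright M)^H\xrightarrow{\ \tau_M\ } \mathrm{Hom}(k,M\triangleleft M)^H\simeq\mathrm{Hom}(M,M)^H.$$ A stable anti-Yetter–Drinfeld module (saYD-module) is a left $H$-module and right $H$-comodule $M$ with $(hm)_0\otimes(hm)_1=h^2m_0\otimes h^3m_1S(h^1)$ and $m_1m_0=m$ for all $h\in H$, $m\in M$; morphisms are the $H$-linear comodule maps. A symmetric $2$-contratrace on $\mathcal{M}^H$ is a contravariant functor $F:\mathcal{M}^H\to\mathrm{Vec}_k$ with natural isomorphisms $\iota_{V,W}:F(V\otimes W)\to F(W\otimes V)$ such that $\iota_{U,V\otimes W}=\iota_{W\otimes U,V}\circ\iota_{U\otimes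 V,W}$ (modulo associators) and $\iota_{W,V}\circ\iota_{V,W}=\mathrm{Id}$; morphisms are the natural transformations that commute with $\iota$. It is representable if $F\simeq\mathrm{Hom}(-,M)^H$ for some comodule $M$. Then: 1. The category of saYD-modules is equivalent to $\mathcal{Z}'$. The equivalence sends $M$ to the comodule $M$ with $\tau_W f(w)=w_1f(w_0)$. 2. The category of saYD-modules is equivalent to the category of representable symmetric $2$-contratraces on $\mathcal{M}^H$. The equivalence sends $M$ to $\mathrm{Hom}(-,M)^H$ with $(\iota_{V,W}f)(w\otimes v)=w_1f(v\otimes w_0)$. -/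

import Mathlib

open CategoryTheory MonoidalCategory TensorProduct Coalgebra

universe u

/-! ### Coactions -/

namespace Coaction

section
variable {k H : Type u} [Field k] [Ring H] [HopfAlgebra k H]
variable {M N P M' N' : Type u} [AddCommGroup M] [Module k M] [AddCommGroup N] [Module k N]
  [AddCommGroup P] [Module k P] [AddCommGroup M'] [Module k M'] [AddCommGroup N'] [Module k N']

/-- `(m ⊗ n)₀ ⊗ (m ⊗ n)₁ = (m₀ ⊗ n₀) ⊗ m₁ n₁`. -/
def tensor (ρM : M →ₗ[k] M ⊗[k] H) (ρN : N →ₗ[k] N ⊗[k] H) : M ⊗[k] N →ₗ[k] (M ⊗[k] N) ⊗[k] H :=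
  (LinearMap.mul' k H).lTensor (M ⊗[k] N) ∘ₗ
    (TensorProduct.tensorTensorTensorComm k M H N H).toLinearMap ∘ₗ TensorProduct.map ρM ρN

lemma tensor_tmul (ρM : M →ₗ[k] M ⊗[k] H) (ρN : N →ₗ[k] N ⊗[k] H) (m : M) (n : N) :
    tensor ρM ρN (m ⊗ₜ n) = (LinearMap.mul' k H).lTensor (M ⊗[k] N)
        (TensorProduct.tensorTensorTensorComm k M H N H (ρM m ⊗ₜ ρN n)) := rfl

lemma tensor_coassoc_aux (ρM : M →ₗ[k] M ⊗[k] H) (ρN : N →ₗ[k] N ⊗[k] H)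
    (s : M ⊗[k] H) (t : N ⊗[k] H) :
    TensorProduct.assoc k (M ⊗[k] N) H H ((tensor ρM ρN).rTensor H
      ((LinearMap.mul' k H).lTensor (M ⊗[k] N)
        (TensorProduct.tensorTensorTensorComm k M H N H (s ⊗ₜ t)))) =
    (LinearMap.mul' k (H ⊗[k] H)).lTensor (M ⊗[k] N)
        (TensorProduct.tensorTensorTensorComm k M (H ⊗[k] H) N (H ⊗[k] H)
          (TensorProduct.assoc k M H H (ρM.rTensor H s) ⊗ₜ
            TensorProduct.assoc k N H H (ρN.rTensor H t))) := by
  induction s with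
  | zero => simp
  | add x y hx hy => simp only [TensorProduct.add_tmul, map_add, hx, hy]
  | tmul m x =>
    induction t with
    | zero => simp
    | add y z hy hz => simp only [TensorProduct.tmul_add, map_add, hy, hz]
    | tmul n y =>
      simp only [tensorTensorTensorComm_tmul, LinearMap.lTensor_tmul, LinearMap.mul'_apply,
        LinearMap.rTensor_tmul, tensor_tmul]
      generalize ρM m = s
      generalize ρN n = t
      induction s with
      | zero => simp
      | add x y hx hy => simp only [TensorProduct.add_tmul, map_add, hx, hy]
      | tmul m a =>
        induction t with
        | zero => simp
        | add y z hy hz =>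
          simp only [TensorProduct.tmul_add, TensorProduct.add_tmul, map_add, hy, hz]
        | tmul n b => simp

lemma tensor_comul_aux (s : M ⊗[k] H) (t : N ⊗[k] H) :
    (comul (R := k) (A := H)).lTensor (M ⊗[k] N)
      ((LinearMap.mul' k H).lTensor (M ⊗[k] N)
        (TensorProduct.tensorTensorTensorComm k M H N H (s ⊗ₜ t))) =
    (LinearMap.mul' k (H ⊗[k] H)).lTensor (M ⊗[k] N)
        (TensorProduct.tensorTensorTensorComm k M (H ⊗[k] H) N (H ⊗[k] H)
          ((comul (R := k) (A := H)).lTensor M s ⊗ₜ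
            (comul (R := k) (A := H)).lTensor N t)) := by
  induction s with
  | zero => simp
  | add x y hx hy => simp only [TensorProduct.add_tmul, map_add, hx, hy]
  | tmul m x =>
    induction t with
    | zero => simp
    | add y z hy hz => simp only [TensorProduct.tmul_add, map_add, hy, hz]
    | tmul n y => simp [Bialgebra.comul_mul]

lemma tensor_counit_aux (s : M ⊗[k] H) (t : N ⊗[k] H) :
    TensorProduct.rid k _ ((counit (R := k) (A := H)).lTensor (M ⊗[k] N)
      ((LinearMap.mul' k H).lTensor (M ⊗[k] N)
        (TensorProduct.tensorTensorTensorComm k M H N H (s ⊗ₜ t)))) =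
    TensorProduct.rid k _ ((counit (R := k) (A := H)).lTensor M s) ⊗ₜ[k]
      TensorProduct.rid k _ ((counit (R := k) (A := H)).lTensor N t) := by
  induction s with
  | zero => simp
  | add x y hx hy => simp only [TensorProduct.add_tmul, map_add, hx, hy]
  | tmul m x =>
    induction t with
    | zero => simp
    | add y z hy hz => simp only [TensorProduct.tmul_add, map_add, hy, hz]
    | tmul n y => simp [TensorProduct.smul_tmul', TensorProduct.tmul_smul, smul_smul, mul_comm]

lemma tensor_coassoc (ρM : M →ₗ[k] M ⊗[k] H) (ρN : N →ₗ[k] N ⊗[k] H)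
    (hM : ∀ m, TensorProduct.assoc k M H H (ρM.rTensor H (ρM m)) =
      (comul (R := k) (A := H)).lTensor M (ρM m))
    (hN : ∀ n, TensorProduct.assoc k N H H (ρN.rTensor H (ρN n)) =
      (comul (R := k) (A := H)).lTensor N (ρN n)) (t : M ⊗[k] N) :
    TensorProduct.assoc k (M ⊗[k] N) H H ((tensor ρM ρN).rTensor H (tensor ρM ρN t)) =
      (comul (R := k) (A := H)).lTensor (M ⊗[k] N) (tensor ρM ρN t) := by
  induction t with
  | zero => simp
  | add x y hx hy => simp only [map_add, hx, hy]
  | tmul m n => rw [tensor_tmul, tensor_coassoc_aux, hM, hN, tensor_comul_aux]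

lemma tensor_counit (ρM : M →ₗ[k] M ⊗[k] H) (ρN : N →ₗ[k] N ⊗[k] H)
    (hM : ∀ m, TensorProduct.rid k M ((counit (R := k) (A := H)).lTensor M (ρM m)) = m)
    (hN : ∀ n, TensorProduct.rid k N ((counit (R := k) (A := H)).lTensor N (ρN n)) = n)
    (t : M ⊗[k] N) :
    TensorProduct.rid k (M ⊗[k] N)
      ((counit (R := k) (A := H)).lTensor (M ⊗[k] N) (tensor ρM ρN t)) = t := by
  induction t with
  | zero => simp
  | add x y hx hy => simp only [map_add, hx, hy]
  | tmul m n => rw [tensor_tmul, tensor_counit_aux, hM, hN]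

lemma tensor_map (ρM : M →ₗ[k] M ⊗[k] H) (ρN : N →ₗ[k] N ⊗[k] H) (ρM' : M' →ₗ[k] M' ⊗[k] H)
    (ρN' : N' →ₗ[k] N' ⊗[k] H) (f : M →ₗ[k] M') (g : N →ₗ[k] N')
    (hf : ∀ m, ρM' (f m) = f.rTensor H (ρM m)) (hg : ∀ n, ρN' (g n) = g.rTensor H (ρN n))
    (t : M ⊗[k] N) :
    tensor ρM' ρN' (TensorProduct.map f g t) =
      (TensorProduct.map f g).rTensor H (tensor ρM ρN t) := by
  induction t with
  | zero => simp
  | add x y hx hy => simp only [map_add, hx, hy]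
  | tmul m n =>
    rw [TensorProduct.map_tmul, tensor_tmul, tensor_tmul, hf, hg]
    generalize ρM m = s
    generalize ρN n = t
    induction s with
    | zero => simp
    | add x y hx hy => simp only [TensorProduct.add_tmul, map_add, hx, hy]
    | tmul m x =>
      induction t with
      | zero => simp
      | add y z hy hz => simp only [TensorProduct.tmul_add, map_add, hy, hz]
      | tmul n y => simp

lemma tensor_assoc (ρM : M →ₗ[k] M ⊗[k] H) (ρN : N →ₗ[k] N ⊗[k] H) (ρP : P →ₗ[k] P ⊗[k] H)
    (t : (M ⊗[k] N) ⊗[k] P) :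
    tensor ρM (tensor ρN ρP) (TensorProduct.assoc k M N P t) =
      (TensorProduct.assoc k M N P).toLinearMap.rTensor H (tensor (tensor ρM ρN) ρP t) := by
  induction t with
  | zero => simp
  | add x y hx hy => simp only [map_add, hx, hy]
  | tmul x p =>
    induction x with
    | zero => simp
    | add x y hx hy => simp only [TensorProduct.add_tmul, map_add, hx, hy]
    | tmul m n =>
      simp only [TensorProduct.assoc_tmul, tensor_tmul]
      generalize ρM m = s
      generalize ρN n = t
      generalize ρP p = r
      induction s with
      | zero => simp
      | add x y hx hy => simp only [TensorProduct.add_tmul, map_add, hx, hy]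
      | tmul m x =>
        induction t with
        | zero => simp
        | add y z hy hz =>
          simp only [TensorProduct.tmul_add, TensorProduct.add_tmul, map_add, hy, hz]
        | tmul n y =>
          induction r with
          | zero => simp
          | add y z hy hz => simp only [TensorProduct.tmul_add, map_add, hy, hz]
          | tmul p z => simp [mul_assoc]

/-- The trivial coaction `c ↦ c ⊗ 1` on `k`. -/
def unit (k H : Type u) [Field k] [Ring H] [HopfAlgebra k H] : k →ₗ[k] k ⊗[k] H :=
  (TensorProduct.mk k k H).flip 1

lemma tensor_lid (ρM : M →ₗ[k] M ⊗[k] H) (t : k ⊗[k] M) :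
    ρM (TensorProduct.lid k M t) =
      (TensorProduct.lid k M).toLinearMap.rTensor H (tensor (unit k H) ρM t) := by
  induction t with
  | zero => simp
  | add x y hx hy => simp only [map_add, hx, hy]
  | tmul c m =>
    simp only [tensor_tmul, TensorProduct.lid_tmul, map_smul, unit, LinearMap.flip_apply,
      TensorProduct.mk_apply]
    generalize ρM m = s
    induction s with
    | zero => simp
    | add x y hx hy => simp only [TensorProduct.tmul_add, smul_add, map_add, hx, hy]
    | tmul m x => simp [TensorProduct.smul_tmul']

lemma tensor_rid (ρM : M →ₗ[k] M ⊗[k] H) (t : M ⊗[k] k) :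
    ρM (TensorProduct.rid k M t) =
      (TensorProduct.rid k M).toLinearMap.rTensor H (tensor ρM (unit k H) t) := by
  induction t with
  | zero => simp
  | add x y hx hy => simp only [map_add, hx, hy]
  | tmul m c =>
    simp only [tensor_tmul, TensorProduct.rid_tmul, map_smul, unit, LinearMap.flip_apply,
      TensorProduct.mk_apply]
    generalize ρM m = s
    induction s with
    | zero => simp
    | add x y hx hy => simp only [TensorProduct.add_tmul, smul_add, map_add, hx, hy]
    | tmul m x => simp [TensorProduct.smul_tmul']

end
end Coaction

/-- A right comodule over `H`. -/
structure Comod (k H : Type u) [Field k] [Ring H] [HopfAlgebra k H] where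
  carrier : Type u
  [addCommGroup : AddCommGroup carrier]
  [module : Module k carrier]
  /-- the coaction `m ↦ m₀ ⊗ m₁` -/
  coact : carrier →ₗ[k] carrier ⊗[k] H
  coassoc : ∀ m, TensorProduct.assoc k carrier H H (coact.rTensor H (coact m)) =
    (comul (R := k) (A := H)).lTensor carrier (coact m)
  counit_coact : ∀ m, TensorProduct.rid k carrier
    ((counit (R := k) (A := H)).lTensor carrier (coact m)) = m

namespace Comod

attribute [instance] Comod.addCommGroup Comod.module

section
variable {k H : Type u} [Field k] [Ring H] [HopfAlgebra k H]

/-- The `k`-linear maps `M → N` that commute with the coactions. -/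
def homSubmodule (M N : Comod k H) : Submodule k (M.carrier →ₗ[k] N.carrier) where
  carrier := {f | ∀ m, N.coact (f m) = f.rTensor H (M.coact m)}
  add_mem' hf hg m := by simp [hf m, hg m, LinearMap.rTensor_add]
  zero_mem' m := by simp
  smul_mem' c f hf m := by simp [hf m, LinearMap.rTensor_smul]

instance : Category (Comod k H) where
  Hom M N := homSubmodule M N
  id M := ⟨LinearMap.id, fun m => by simp⟩
  comp f g := ⟨g.1 ∘ₗ f.1, fun m => by
    rw [LinearMap.comp_apply, g.2, f.2, LinearMap.rTensor_comp_apply]⟩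

/-- The linear map underlying a comodule morphism. -/
def lin {M N : Comod k H} (f : M ⟶ N) : M.carrier →ₗ[k] N.carrier :=
  Subtype.val (p := (· ∈ homSubmodule M N)) f

lemma coact_lin {M N : Comod k H} (f : M ⟶ N) (m : M.carrier) :
    N.coact (lin f m) = (lin f).rTensor H (M.coact m) :=
  Subtype.property (p := (· ∈ homSubmodule M N)) f m

/-- Comodule morphisms from linear maps. -/
def mkHom {M N : Comod k H} (f : M.carrier →ₗ[k] N.carrier)
    (hf : ∀ m, N.coact (f m) = f.rTensor H (M.coact m)) : M ⟶ N :=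
  (⟨f, hf⟩ : homSubmodule M N)

@[ext] lemma hom_ext {M N : Comod k H} {f g : M ⟶ N} (h : lin f = lin g) : f = g :=
  Subtype.ext h

@[simp] lemma lin_mkHom {M N : Comod k H} (f : M.carrier →ₗ[k] N.carrier) (hf) :
    lin (mkHom (M := M) (N := N) f hf) = f := rfl

@[simp] lemma lin_id (M : Comod k H) : lin (𝟙 M) = LinearMap.id := rfl

@[simp] lemma lin_comp {M N P : Comod k H} (f : M ⟶ N) (g : N ⟶ P) :
    lin (f ≫ g) = lin g ∘ₗ lin f := rfl

instance : Preadditive (Comod k H) where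
  homGroup M N := inferInstanceAs (AddCommGroup (homSubmodule M N))
  add_comp _ _ _ f g h := hom_ext (LinearMap.comp_add (lin f) (lin g) (lin h))
  comp_add _ _ _ f g h := hom_ext (LinearMap.add_comp (lin f) (lin h) (lin g))

instance : Linear k (Comod k H) where
  homModule M N := inferInstanceAs (Module k (homSubmodule M N))
  smul_comp _ _ _ c f g := hom_ext (LinearMap.comp_smul (lin g) c (lin f))
  comp_smul _ _ _ f c g := hom_ext (LinearMap.smul_comp c (lin g) (lin f))

/-- The tensor product comodule. -/
abbrev tensor (M N : Comod k H) : Comod k H where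
  carrier := M.carrier ⊗[k] N.carrier
  coact := Coaction.tensor M.coact N.coact
  coassoc := Coaction.tensor_coassoc M.coact N.coact M.coassoc N.coassoc
  counit_coact := Coaction.tensor_counit M.coact N.coact M.counit_coact N.counit_coact

/-- The trivial comodule `k`. -/
abbrev unit (k H : Type u) [Field k] [Ring H] [HopfAlgebra k H] : Comod k H where
  carrier := k
  coact := Coaction.unit k H
  coassoc m := by simp [Coaction.unit, Algebra.TensorProduct.one_def]
  counit_coact m := by simp [Coaction.unit]

/-- Isomorphisms of comodules from linear equivalences. -/
def mkIso {M N : Comod k H} (e : M.carrier ≃ₗ[k] N.carrier)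
    (he : ∀ m, N.coact (e m) = e.toLinearMap.rTensor H (M.coact m)) : M ≅ N where
  hom := mkHom e.toLinearMap he
  inv := mkHom e.symm.toLinearMap fun n => by
    obtain ⟨m, rfl⟩ := e.surjective n
    have h := congrArg (e.symm.toLinearMap.rTensor H) (he m)
    rw [← LinearMap.rTensor_comp_apply] at h
    simpa using h.symm
  hom_inv_id := by ext m; simp
  inv_hom_id := by ext m; simp

/-- Tensor product of comodule morphisms. -/
def tensorHom {M M' N N' : Comod k H} (f : M ⟶ M') (g : N ⟶ N') : tensor M N ⟶ tensor M' N' :=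
  mkHom (M := tensor M N) (N := tensor M' N') (TensorProduct.map (lin f) (lin g))
    (Coaction.tensor_map _ _ _ _ _ _ (coact_lin f) (coact_lin g))

instance : MonoidalCategory (Comod k H) where
  tensorObj := tensor
  tensorHom := tensorHom
  whiskerLeft M _ _ g := tensorHom (𝟙 M) g
  whiskerRight f N := tensorHom f (𝟙 N)
  tensorUnit := unit k H
  associator M N P := mkIso (M := tensor (tensor M N) P) (N := tensor M (tensor N P))
    (TensorProduct.assoc k M.carrier N.carrier P.carrier) (Coaction.tensor_assoc _ _ _)
  leftUnitor M := mkIso (M := tensor (unit k H) M) (TensorProduct.lid k M.carrier)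
    (Coaction.tensor_lid _)
  rightUnitor M := mkIso (M := tensor M (unit k H)) (TensorProduct.rid k M.carrier)
    (Coaction.tensor_rid _)
  tensorHom_def _ _ := hom_ext (TensorProduct.ext' fun _ _ => rfl)
  id_tensorHom_id _ _ := hom_ext (TensorProduct.ext' fun _ _ => rfl)
  tensorHom_comp_tensorHom _ _ _ _ := hom_ext (TensorProduct.ext' fun _ _ => rfl)
  whiskerLeft_id _ _ := hom_ext (TensorProduct.ext' fun _ _ => rfl)
  id_whiskerRight _ _ := hom_ext (TensorProduct.ext' fun _ _ => rfl)
  associator_naturality _ _ _ := hom_ext (TensorProduct.ext_threefold fun _ _ _ => rfl)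
  leftUnitor_naturality f :=
    hom_ext (TensorProduct.ext' fun (c : k) m => (map_smul (lin f) c m).symm)
  rightUnitor_naturality f :=
    hom_ext (TensorProduct.ext' fun m (c : k) => (map_smul (lin f) c m).symm)
  pentagon _ _ _ _ := hom_ext (TensorProduct.ext_fourfold fun _ _ _ _ => rfl)
  triangle _ _ := hom_ext (TensorProduct.ext_threefold fun m (c : k) n =>
    (TensorProduct.smul_tmul c m n).symm)

end
end Comod

/-! ### The antipode and its inverse -/

/-- The antipode of `H` is invertible. -/
class BijectiveAntipode (k H : Type u) [Field k] [Ring H] [HopfAlgebra k H] : Prop where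
  bijective : Function.Bijective (HopfAlgebra.antipode k : H →ₗ[k] H)

namespace Coaction

section
variable (k H : Type u) [Field k] [Ring H] [HopfAlgebra k H]

/-- The inverse `S⁻¹` of the antipode. -/
noncomputable def antipodeInv [BijectiveAntipode k H] : H →ₗ[k] H :=
  (LinearEquiv.ofBijective (HopfAlgebra.antipode k : H →ₗ[k] H)
    BijectiveAntipode.bijective).symm.toLinearMap

variable {k H}

@[simp] lemma antipodeInv_antipode [BijectiveAntipode k H] (x : H) :
    antipodeInv k H (HopfAlgebra.antipode k x) = x :=
  (LinearEquiv.ofBijective (HopfAlgebra.antipode k : H →ₗ[k] H)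
    BijectiveAntipode.bijective).symm_apply_apply x

@[simp] lemma antipode_antipodeInv [BijectiveAntipode k H] (x : H) :
    HopfAlgebra.antipode k (antipodeInv k H x) = x :=
  (LinearEquiv.ofBijective (HopfAlgebra.antipode k : H →ₗ[k] H)
    BijectiveAntipode.bijective).apply_symm_apply x

lemma antipode_comul_aux (e : H) :
    LinearMap.mul' k (H ⊗[k] H) (TensorProduct.map
      ((TensorProduct.mk k H H).flip 1 ∘ₗ HopfAlgebra.antipode k) comul (comul (R := k) e)) =
      1 ⊗ₜ[k] e := by
  have key : ∀ t : H ⊗[k] H, LinearMap.mul' k (H ⊗[k] H) (TensorProduct.map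
      ((TensorProduct.mk k H H).flip 1 ∘ₗ HopfAlgebra.antipode k) comul t) =
      (LinearMap.mul' k H ∘ₗ (HopfAlgebra.antipode k).rTensor H).rTensor H
        ((TensorProduct.assoc k H H H).symm ((comul (R := k)).lTensor H t)) := by
    intro t
    induction t with
    | zero => simp
    | add x y hx hy => simp only [map_add, hx, hy]
    | tmul a b =>
      simp only [TensorProduct.map_tmul, LinearMap.lTensor_tmul]
      generalize (comul (R := k) b : H ⊗[k] H) = s
      induction s with
      | zero => simp
      | add x y hx hy => simp only [TensorProduct.tmul_add, map_add, hx, hy]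
      | tmul c d => simp
  rw [key, ← Coalgebra.coassoc_apply, LinearEquiv.symm_apply_apply, ← LinearMap.rTensor_comp_apply,
    LinearMap.comp_assoc, HopfAlgebra.mul_antipode_rTensor_comul, LinearMap.rTensor_comp_apply,
    Coalgebra.rTensor_counit_comul]
  simp

lemma comul_antipode (x : H) : comul (R := k) (HopfAlgebra.antipode k x) =
    TensorProduct.map (HopfAlgebra.antipode k) (HopfAlgebra.antipode k)
      (TensorProduct.comm k H H (comul (R := k) x)) := by
  let G : H →ₗ[k] H ⊗[k] H :=
    TensorProduct.map (HopfAlgebra.antipode k) (HopfAlgebra.antipode k) ∘ₗ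
      (TensorProduct.comm k H H).toLinearMap ∘ₗ comul
  have h1 : WithConv.toConv G * WithConv.toConv (comul (R := k) (A := H)) = 1 := by
    apply WithConv.ext
    ext c
    simp only [LinearMap.convMul_def, LinearMap.convOne_def]
    change LinearMap.mul' k (H ⊗[k] H) (TensorProduct.map G comul (comul (R := k) c)) =
      algebraMap k (H ⊗[k] H) (counit c)
    let Ψ : H ⊗[k] (H ⊗[k] H) →ₗ[k] H ⊗[k] H :=
      LinearMap.mul' k (H ⊗[k] H) ∘ₗ TensorProduct.map
        (TensorProduct.mk k H H 1 ∘ₗ HopfAlgebra.antipode k)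
        (LinearMap.mul' k (H ⊗[k] H) ∘ₗ TensorProduct.map
          ((TensorProduct.mk k H H).flip 1 ∘ₗ HopfAlgebra.antipode k) comul)
    have key : ∀ t : H ⊗[k] H, LinearMap.mul' k (H ⊗[k] H) (TensorProduct.map G comul t) =
        Ψ (TensorProduct.assoc k H H H ((comul (R := k)).rTensor H t)) := by
      intro t
      induction t with
      | zero => simp
      | add x y hx hy => simp only [map_add, hx, hy]
      | tmul a b =>
        simp only [TensorProduct.map_tmul, LinearMap.rTensor_tmul, G, LinearMap.comp_apply,
          LinearEquiv.coe_coe]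
        generalize (comul (R := k) a : H ⊗[k] H) = s
        induction s with
        | zero => simp
        | add x y hx hy => simp only [TensorProduct.add_tmul, map_add, hx, hy]
        | tmul c d =>
          simp only [TensorProduct.comm_tmul, TensorProduct.map_tmul, LinearMap.mul'_apply,
            TensorProduct.assoc_tmul, Ψ, LinearMap.comp_apply, LinearMap.flip_apply,
            TensorProduct.mk_apply]
          rw [← mul_assoc, Algebra.TensorProduct.tmul_mul_tmul]
          simp
    have key2 : ∀ t : H ⊗[k] H, Ψ ((comul (R := k)).lTensor H t) =
        1 ⊗ₜ LinearMap.mul' k H ((HopfAlgebra.antipode k).rTensor H t) := by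
      intro t
      induction t with
      | zero => simp
      | add x y hx hy => simp only [map_add, hx, hy, TensorProduct.tmul_add]
      | tmul a b =>
        simp only [LinearMap.lTensor_tmul, Ψ, LinearMap.comp_apply, TensorProduct.map_tmul]
        rw [antipode_comul_aux]
        simp
    rw [key, Coalgebra.coassoc_apply, key2, HopfAlgebra.mul_antipode_rTensor_comul_apply]
    simp [Algebra.algebraMap_eq_smul_one, Algebra.TensorProduct.one_def]
  have h2 := left_inv_eq_right_inv h1 LinearMap.comul_right_inv
  have h3 := congrArg WithConv.ofConv h2
  exact (LinearMap.congr_fun h3 x).symm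

lemma comul_antipodeInv [BijectiveAntipode k H] (x : H) :
    comul (R := k) (antipodeInv k H x) =
    TensorProduct.map (antipodeInv k H) (antipodeInv k H)
      (TensorProduct.comm k H H (comul (R := k) x)) := by
  obtain ⟨y, rfl⟩ := (BijectiveAntipode.bijective (k := k) (H := H)).2 x
  rw [comul_antipode, antipodeInv_antipode]
  generalize (comul (R := k) y : H ⊗[k] H) = s
  induction s with
  | zero => simp
  | add x y hx hy => simp only [map_add, ← hx, ← hy]
  | tmul c d => simp

lemma counit_antipodeInv [BijectiveAntipode k H] (x : H) :
    counit (R := k) (antipodeInv k H x) = counit (R := k) x := by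
  obtain ⟨y, rfl⟩ := (BijectiveAntipode.bijective (k := k) (H := H)).2 x
  simp

/-- `h ⊗ x ↦ h S(x)` -/
noncomputable def mulS (k H : Type u) [Field k] [Ring H] [HopfAlgebra k H] : H ⊗[k] H →ₗ[k] H :=
  LinearMap.mul' k H ∘ₗ (HopfAlgebra.antipode k).lTensor H

/-- `h ⊗ x ↦ S⁻¹(x) h` -/
noncomputable def mulSInv (k H : Type u) [Field k] [Ring H] [HopfAlgebra k H]
    [BijectiveAntipode k H] : H ⊗[k] H →ₗ[k] H :=
  LinearMap.mul' k H ∘ₗ (antipodeInv k H).rTensor H ∘ₗ (TensorProduct.comm k H H).toLinearMap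

/-- `μ : H ⊗ Hᶜᵒᵖ → H` is a map of coalgebras. -/
structure IsCoalgTwist (μ : H ⊗[k] H →ₗ[k] H) : Prop where
  comul : ∀ h x, comul (R := k) (μ (h ⊗ₜ x)) = TensorProduct.map μ μ
    (TensorProduct.tensorTensorTensorComm k H H H H
      (Coalgebra.comul (R := k) h ⊗ₜ TensorProduct.comm k H H (Coalgebra.comul (R := k) x)))
  counit : ∀ h x, counit (R := k) (μ (h ⊗ₜ x)) =
    Coalgebra.counit (R := k) h * Coalgebra.counit (R := k) x

lemma isCoalgTwist_mulS : IsCoalgTwist (mulS k H) where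
  comul h x := by
    simp only [mulS, LinearMap.comp_apply, LinearMap.lTensor_tmul, LinearMap.mul'_apply,
      Bialgebra.comul_mul, comul_antipode]
    generalize (Coalgebra.comul (R := k) h : H ⊗[k] H) = s
    generalize (Coalgebra.comul (R := k) x : H ⊗[k] H) = t
    induction s with
    | zero => simp
    | add x y hx hy => simp only [TensorProduct.add_tmul, add_mul, map_add, hx, hy]
    | tmul a b =>
      induction t with
      | zero => simp
      | add x y hx hy => simp only [TensorProduct.tmul_add, mul_add, map_add, hx, hy]
      | tmul c d => simp
  counit h x := by simp [mulS]

lemma isCoalgTwist_mulSInv [BijectiveAntipode k H] : IsCoalgTwist (mulSInv k H) where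
  comul h x := by
    simp only [mulSInv, LinearMap.comp_apply, LinearMap.rTensor_tmul, LinearMap.mul'_apply,
      LinearEquiv.coe_coe, TensorProduct.comm_tmul, Bialgebra.comul_mul, comul_antipodeInv]
    generalize (Coalgebra.comul (R := k) h : H ⊗[k] H) = s
    generalize (Coalgebra.comul (R := k) x : H ⊗[k] H) = t
    induction s with
    | zero => simp
    | add x y hx hy => simp only [TensorProduct.add_tmul, mul_add, map_add, hx, hy]
    | tmul a b =>
      induction t with
      | zero => simp
      | add x y hx hy => simp only [TensorProduct.tmul_add, add_mul, map_add, hx, hy]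
      | tmul c d => simp
  counit h x := by simp [mulSInv, counit_antipodeInv, mul_comm]

/-- `ν(μ(h, x₁), x₂) = ε(x) h` -/
def IsLeftInv (ν μ : H ⊗[k] H →ₗ[k] H) : Prop :=
  ∀ h x, ν (μ.rTensor H ((TensorProduct.assoc k H H H).symm (h ⊗ₜ comul (R := k) x))) =
    counit (R := k) x • h

lemma mul_mulS : IsLeftInv (LinearMap.mul' k H) (mulS k H) := by
  intro h x
  have key : ∀ t : H ⊗[k] H, LinearMap.mul' k H ((mulS k H).rTensor H
      ((TensorProduct.assoc k H H H).symm (h ⊗ₜ t))) =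
      h * LinearMap.mul' k H ((HopfAlgebra.antipode k).rTensor H t) := by
    intro t
    induction t with
    | zero => simp
    | add x y hx hy => simp only [TensorProduct.tmul_add, map_add, mul_add, hx, hy]
    | tmul a b => simp [mulS, mul_assoc]
  rw [key, HopfAlgebra.mul_antipode_rTensor_comul_apply]
  simp [Algebra.algebraMap_eq_smul_one]

lemma mulS_mul : IsLeftInv (mulS k H) (LinearMap.mul' k H) := by
  intro h x
  have key : ∀ t : H ⊗[k] H, mulS k H ((LinearMap.mul' k H).rTensor H
      ((TensorProduct.assoc k H H H).symm (h ⊗ₜ t))) =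
      h * LinearMap.mul' k H ((HopfAlgebra.antipode k).lTensor H t) := by
    intro t
    induction t with
    | zero => simp
    | add x y hx hy => simp only [TensorProduct.tmul_add, map_add, mul_add, hx, hy]
    | tmul a b => simp [mulS, mul_assoc]
  rw [key, HopfAlgebra.mul_antipode_lTensor_comul_apply]
  simp [Algebra.algebraMap_eq_smul_one]

/-- `h ⊗ x ↦ x h` -/
noncomputable def mulOp (k H : Type u) [Field k] [Ring H] [HopfAlgebra k H] : H ⊗[k] H →ₗ[k] H :=
  LinearMap.mul' k H ∘ₗ (TensorProduct.comm k H H).toLinearMap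

lemma mulOp_mulSInv [BijectiveAntipode k H] : IsLeftInv (mulOp k H) (mulSInv k H) := by
  intro h x
  have key : ∀ t : H ⊗[k] H, mulOp k H ((mulSInv k H).rTensor H
      ((TensorProduct.assoc k H H H).symm (h ⊗ₜ t))) =
      antipodeInv k H (LinearMap.mul' k H ((HopfAlgebra.antipode k).lTensor H t)) * h := by
    intro t
    induction t with
    | zero => simp
    | add x y hx hy => simp only [TensorProduct.tmul_add, map_add, add_mul, hx, hy]
    | tmul a b =>
      have : antipodeInv k H (a * HopfAlgebra.antipode k b) = b * antipodeInv k H a := by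
        apply (BijectiveAntipode.bijective (k := k) (H := H)).1
        simp [HopfAlgebra.antipode_mul_antidistrib]
      simp [mulOp, mulSInv, this, mul_assoc]
  have h1 : antipodeInv k H (1 : H) = 1 := by
    apply (BijectiveAntipode.bijective (k := k) (H := H)).1
    simp
  rw [key, HopfAlgebra.mul_antipode_lTensor_comul_apply]
  simp [Algebra.algebraMap_eq_smul_one, h1]

lemma mulSInv_mulOp [BijectiveAntipode k H] : IsLeftInv (mulSInv k H) (mulOp k H) := by
  intro h x
  have key : ∀ t : H ⊗[k] H, mulSInv k H ((mulOp k H).rTensor H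
      ((TensorProduct.assoc k H H H).symm (h ⊗ₜ t))) =
      antipodeInv k H (LinearMap.mul' k H ((HopfAlgebra.antipode k).rTensor H t)) * h := by
    intro t
    induction t with
    | zero => simp
    | add x y hx hy => simp only [TensorProduct.tmul_add, map_add, add_mul, hx, hy]
    | tmul a b =>
      have : antipodeInv k H (HopfAlgebra.antipode k a * b) = antipodeInv k H b * a := by
        apply (BijectiveAntipode.bijective (k := k) (H := H)).1
        simp [HopfAlgebra.antipode_mul_antidistrib]
      simp [mulOp, mulSInv, this, mul_assoc]
  have h1 : antipodeInv k H (1 : H) = 1 := by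
    apply (BijectiveAntipode.bijective (k := k) (H := H)).1
    simp
  rw [key, HopfAlgebra.mul_antipode_rTensor_comul_apply]
  simp [Algebra.algebraMap_eq_smul_one, h1]

end
end Coaction

/-! ### The comodule of rational linear maps -/

namespace Coaction

section
variable {k H : Type u} [Field k] [Ring H] [HopfAlgebra k H]
variable {W V V' : Type u} [AddCommGroup W] [Module k W] [AddCommGroup V] [Module k V]
  [AddCommGroup V'] [Module k V']

/-- The canonical map `Hom(W, V) ⊗ Q → Hom(W, V ⊗ Q)`. -/
noncomputable def can (k W V Q : Type u) [Field k] [AddCommGroup W] [Module k W] [AddCommGroup V]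
    [Module k V] [AddCommGroup Q] [Module k Q] :
    (W →ₗ[k] V) ⊗[k] Q →ₗ[k] (W →ₗ[k] V ⊗[k] Q) :=
  TensorProduct.rTensorHomToHomRTensor (RingHom.id k) W V Q

@[simp] lemma can_tmul {Q : Type u} [AddCommGroup Q] [Module k Q] (f : W →ₗ[k] V) (q : Q) (w : W) :
    can k W V Q (f ⊗ₜ q) w = f w ⊗ₜ q := rfl

/-- Contraction of the last tensor factor. -/
noncomputable def contract {E Q : Type u} [AddCommGroup E] [Module k E] [AddCommGroup Q]
    [Module k Q] (c : Q →ₗ[k] k) : E ⊗[k] Q →ₗ[k] E :=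
  (TensorProduct.rid k E).toLinearMap ∘ₗ c.lTensor E

@[simp] lemma contract_tmul {E Q : Type u} [AddCommGroup E] [Module k E] [AddCommGroup Q]
    [Module k Q] (c : Q →ₗ[k] k) (e : E) (q : Q) : contract c (e ⊗ₜ[k] q) = c q • e := by
  simp [contract]

lemma mem_range_of_contract {E Q : Type u} [AddCommGroup E] [Module k E] [AddCommGroup Q]
    [Module k Q] (E' : Submodule k E) (z : E ⊗[k] Q)
    (hz : ∀ c : Q →ₗ[k] k, contract c z ∈ E') : z ∈ LinearMap.range (E'.subtype.rTensor Q) := by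
  classical
  let b := Module.Basis.ofVectorSpace k Q
  have h : ∀ t : E ⊗[k] Q, t = ((TensorProduct.equivFinsuppOfBasisRight b) t).sum
      (fun i e => e ⊗ₜ b i) := by
    intro t
    rw [← TensorProduct.equivFinsuppOfBasisRight_symm_apply, LinearEquiv.symm_apply_apply]
  have h2 : ∀ (t : E ⊗[k] Q) i, (TensorProduct.equivFinsuppOfBasisRight b) t i =
      contract (b.coord i) t := by
    intro t i
    induction t with
    | zero => simp
    | add x y hx hy => simp [hx, hy]
    | tmul e q => simp
  rw [h z]
  refine Submodule.sum_mem _ fun i _ => ?_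
  refine ⟨⟨_, hz (b.coord i)⟩ ⊗ₜ b i, ?_⟩
  simp [h2]

lemma ext_contract {E Q : Type u} [AddCommGroup E] [Module k E] [AddCommGroup Q]
    [Module k Q] {z : E ⊗[k] Q} (hz : ∀ c : Q →ₗ[k] k, contract c z = 0) : z = 0 := by
  obtain ⟨y, rfl⟩ := mem_range_of_contract ⊥ z (fun c => by simp [hz c])
  have : (⊥ : Submodule k E).subtype = 0 := by ext ⟨x, hx⟩; simpa using hx
  simp [this]

lemma contract_can {Q : Type u} [AddCommGroup Q] [Module k Q] (c : Q →ₗ[k] k)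
    (z : (W →ₗ[k] V) ⊗[k] Q) (w : W) : contract c (can k W V Q z w) = contract c z w := by
  induction z with
  | zero => simp
  | add x y hx hy => simp [hx, hy]
  | tmul e q => simp

lemma can_injective (Q : Type u) [AddCommGroup Q] [Module k Q] :
    Function.Injective (can k W V Q) := by
  refine (injective_iff_map_eq_zero _).2 fun z hz => ext_contract fun c => ?_
  ext w
  rw [← contract_can, hz]
  simp

/-- For `F(w) = w¹ ⊗ w²` this is `w ↦ (w₀)¹ ⊗ μ((w₀)², w₁)`. -/
noncomputable def twist (μ : H ⊗[k] H →ₗ[k] H) (ρW : W →ₗ[k] W ⊗[k] H) (F : W →ₗ[k] V ⊗[k] H) :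
    W →ₗ[k] V ⊗[k] H :=
  μ.lTensor V ∘ₗ (TensorProduct.assoc k V H H).toLinearMap ∘ₗ F.rTensor H ∘ₗ ρW

/-- `f ↦ (w ↦ f(w₀)₀ ⊗ μ(f(w₀)₁, w₁))` -/
noncomputable def homCoact (μ : H ⊗[k] H →ₗ[k] H) (ρW : W →ₗ[k] W ⊗[k] H)
    (ρV : V →ₗ[k] V ⊗[k] H) : (W →ₗ[k] V) →ₗ[k] (W →ₗ[k] V ⊗[k] H) where
  toFun f := twist μ ρW (ρV ∘ₗ f)
  map_add' f g := by
    simp [twist, LinearMap.comp_add, LinearMap.add_comp, LinearMap.rTensor_add]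
  map_smul' c f := by
    simp [twist, LinearMap.comp_smul, LinearMap.smul_comp, LinearMap.rTensor_smul]

lemma homCoact_apply (μ : H ⊗[k] H →ₗ[k] H) (ρW : W →ₗ[k] W ⊗[k] H) (ρV : V →ₗ[k] V ⊗[k] H)
    (f : W →ₗ[k] V) (w : W) : homCoact μ ρW ρV f w =
      μ.lTensor V (TensorProduct.assoc k V H H ((ρV ∘ₗ f).rTensor H (ρW w))) := rfl

/-- The maps `f : W → V` with `homCoact f ∈ Hom(W, V) ⊗ H`. -/
noncomputable def ratHom (μ : H ⊗[k] H →ₗ[k] H) (ρW : W →ₗ[k] W ⊗[k] H) (ρV : V →ₗ[k] V ⊗[k] H) :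
    Submodule k (W →ₗ[k] V) :=
  (LinearMap.range (can k W V H)).comap (homCoact μ ρW ρV)

lemma twist_twist {ν μ : H ⊗[k] H →ₗ[k] H} (h : IsLeftInv ν μ) (ρW : W →ₗ[k] W ⊗[k] H)
    (hW : ∀ m, TensorProduct.assoc k W H H (ρW.rTensor H (ρW m)) =
      (comul (R := k) (A := H)).lTensor W (ρW m))
    (hW' : ∀ m, TensorProduct.rid k W ((counit (R := k) (A := H)).lTensor W (ρW m)) = m)
    (F : W →ₗ[k] V ⊗[k] H) : twist ν ρW (twist μ ρW F) = F := by
  ext w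
  let Φ : (W ⊗[k] H) ⊗[k] H →ₗ[k] V ⊗[k] H :=
    ν.lTensor V ∘ₗ (TensorProduct.assoc k V H H).toLinearMap ∘ₗ
      (μ.lTensor V ∘ₗ (TensorProduct.assoc k V H H).toLinearMap ∘ₗ F.rTensor H).rTensor H
  have h1 : twist ν ρW (twist μ ρW F) w = Φ (ρW.rTensor H (ρW w)) := by
    simp only [twist, LinearMap.comp_apply, LinearEquiv.coe_coe, Φ, LinearMap.rTensor_comp]
  have h2 : ∀ t : W ⊗[k] H, Φ ((TensorProduct.assoc k W H H).symm
      ((comul (R := k) (A := H)).lTensor W t)) = F (contract counit t) := by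
    intro t
    induction t with
    | zero => simp
    | add x y hx hy => simp only [map_add, hx, hy]
    | tmul w x =>
      have h3 : ∀ (s : V ⊗[k] H) (y : H ⊗[k] H), ν.lTensor V (TensorProduct.assoc k V H H
          ((μ.lTensor V ∘ₗ (TensorProduct.assoc k V H H).toLinearMap).rTensor H
            ((TensorProduct.assoc k (V ⊗[k] H) H H).symm (s ⊗ₜ y)))) =
          (TensorProduct.lift ((TensorProduct.mk k H (H ⊗[k] H)).compr₂
              (ν ∘ₗ μ.rTensor H ∘ₗ (TensorProduct.assoc k H H H).symm.toLinearMap))).lTensor V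
            (TensorProduct.assoc k V H (H ⊗[k] H) (s ⊗ₜ y)) := by
        intro s y
        induction y with
        | zero => simp
        | add x y hx hy => simp only [TensorProduct.tmul_add, map_add, hx, hy]
        | tmul a b =>
          induction s with
          | zero => simp
          | add x y hx hy => simp only [TensorProduct.add_tmul, map_add, hx, hy]
          | tmul v h => simp
      have h4 : ∀ y : H ⊗[k] H, Φ ((TensorProduct.assoc k W H H).symm (w ⊗ₜ y)) =
          ν.lTensor V (TensorProduct.assoc k V H H
          ((μ.lTensor V ∘ₗ (TensorProduct.assoc k V H H).toLinearMap).rTensor H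
            ((TensorProduct.assoc k (V ⊗[k] H) H H).symm (F w ⊗ₜ y)))) := by
        intro y
        induction y with
        | zero => simp
        | add x y hx hy => simp only [TensorProduct.tmul_add, map_add, hx, hy]
        | tmul a b => simp [Φ]
      rw [LinearMap.lTensor_tmul, h4, h3, contract_tmul, map_smul]
      generalize F w = s
      induction s with
      | zero => simp
      | add x y hx hy => simp only [TensorProduct.add_tmul, smul_add, map_add, hx, hy]
      | tmul v y =>
        have := h y x
        simp only [TensorProduct.assoc_tmul, LinearMap.lTensor_tmul, TensorProduct.lift.tmul,
          LinearMap.compr₂_apply, TensorProduct.mk_apply, LinearMap.comp_apply,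
          LinearEquiv.coe_coe, this, TensorProduct.tmul_smul]
  rw [h1, ← (TensorProduct.assoc k W H H).symm_apply_apply (ρW.rTensor H (ρW w)), hW, h2]
  exact congrArg F (hW' w)

section
variable {μ : H ⊗[k] H →ₗ[k] H} {ρW : W →ₗ[k] W ⊗[k] H} {ρV : V →ₗ[k] V ⊗[k] H}

/-- `(v ⊗ h) ⊗ x ↦ (v₀ ⊗ μ(v₁, x)) ⊗ h` -/
noncomputable def homCoactAux (μ : H ⊗[k] H →ₗ[k] H) (ρV : V →ₗ[k] V ⊗[k] H) :
    (V ⊗[k] H) ⊗[k] H →ₗ[k] (V ⊗[k] H) ⊗[k] H :=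
  (μ.lTensor V ∘ₗ (TensorProduct.assoc k V H H).toLinearMap ∘ₗ ρV.rTensor H).rTensor H ∘ₗ
    (TensorProduct.rightComm k V H H).toLinearMap

lemma homCoactAux_can (z : (W →ₗ[k] V) ⊗[k] H) (w : W) :
    can k W (V ⊗[k] H) H ((homCoact μ ρW ρV).rTensor H z) w =
      homCoactAux μ ρV ((can k W V H z).rTensor H (ρW w)) := by
  induction z with
  | zero => simp
  | add x y hx hy =>
    simp only [map_add, LinearMap.add_apply, LinearMap.rTensor_add, hx, hy]
  | tmul f h =>
    simp only [LinearMap.rTensor_tmul, can_tmul, homCoact_apply]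
    generalize ρW w = s
    induction s with
    | zero => simp
    | add x y hx hy => simp only [map_add, TensorProduct.add_tmul, hx, hy]
    | tmul w x => simp [homCoactAux]

lemma homCoactAux_homCoact (hμ : IsCoalgTwist μ)
    (hW : ∀ m, TensorProduct.assoc k W H H (ρW.rTensor H (ρW m)) =
        (comul (R := k) (A := H)).lTensor W (ρW m))
    (hV : ∀ m, TensorProduct.assoc k V H H (ρV.rTensor H (ρV m)) =
        (comul (R := k) (A := H)).lTensor V (ρV m))
    (f : W →ₗ[k] V) (w : W) :
    homCoactAux μ ρV ((homCoact μ ρW ρV f).rTensor H (ρW w)) =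
      (TensorProduct.assoc k V H H).symm
        ((comul (R := k) (A := H)).lTensor V (homCoact μ ρW ρV f w)) := by
  let Θ : (V ⊗[k] H) ⊗[k] H →ₗ[k] V ⊗[k] H :=
    μ.lTensor V ∘ₗ (TensorProduct.assoc k V H H).toLinearMap
  have h1 : (homCoact μ ρW ρV f).rTensor H (ρW w) =
      (Θ ∘ₗ (ρV ∘ₗ f).rTensor H).rTensor H (ρW.rTensor H (ρW w)) := by
    rw [← LinearMap.rTensor_comp_apply]; rfl
  rw [h1, ← (TensorProduct.assoc k W H H).symm_apply_apply (ρW.rTensor H (ρW w)), hW,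
    homCoact_apply]
  generalize ρW w = t
  induction t with
  | zero => simp
  | add x y hx hy => simp only [map_add, hx, hy]
  | tmul w x =>
    have h2 : ∀ y : H ⊗[k] H, (Θ ∘ₗ (ρV ∘ₗ f).rTensor H).rTensor H
        ((TensorProduct.assoc k W H H).symm (w ⊗ₜ y)) =
        Θ.rTensor H ((TensorProduct.assoc k (V ⊗[k] H) H H).symm (ρV (f w) ⊗ₜ y)) := by
      intro y
      induction y with
      | zero => simp
      | add x y hx hy => simp only [TensorProduct.tmul_add, map_add, hx, hy]
      | tmul a b => simp
    let K : ((V ⊗[k] H) ⊗[k] H) ⊗[k] (H ⊗[k] H) →ₗ[k] (V ⊗[k] H) ⊗[k] H :=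
      (TensorProduct.assoc k V H H).symm.toLinearMap ∘ₗ
      (TensorProduct.map μ μ ∘ₗ
        (TensorProduct.tensorTensorTensorComm k H H H H).toLinearMap ∘ₗ
        (TensorProduct.comm k H H).toLinearMap.lTensor (H ⊗[k] H)).lTensor V ∘ₗ
      (TensorProduct.assoc k V (H ⊗[k] H) (H ⊗[k] H)).toLinearMap ∘ₗ
      (TensorProduct.assoc k V H H).toLinearMap.rTensor (H ⊗[k] H)
    have h3 : ∀ (s : V ⊗[k] H) (y : H ⊗[k] H), homCoactAux μ ρV
        (Θ.rTensor H ((TensorProduct.assoc k (V ⊗[k] H) H H).symm (s ⊗ₜ y))) =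
        K (ρV.rTensor H s ⊗ₜ y) := by
      intro s y
      induction y with
      | zero => simp
      | add x y hx hy => simp only [TensorProduct.tmul_add, map_add, hx, hy]
      | tmul a b =>
        induction s with
        | zero => simp
        | add x y hx hy => simp only [TensorProduct.add_tmul, map_add, hx, hy]
        | tmul v h =>
          simp only [TensorProduct.assoc_symm_tmul, LinearMap.rTensor_tmul, Θ, homCoactAux,
            LinearMap.comp_apply, LinearEquiv.coe_coe, TensorProduct.assoc_tmul,
            LinearMap.lTensor_tmul, TensorProduct.rightComm_tmul, K]
          generalize ρV v = s
          induction s with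
          | zero => simp
          | add x y hx hy => simp only [TensorProduct.add_tmul, map_add, hx, hy]
          | tmul v h => simp
    rw [LinearMap.lTensor_tmul, h2, h3,
      ← (TensorProduct.assoc k V H H).symm_apply_apply (ρV.rTensor H (ρV (f w))), hV,
      LinearMap.rTensor_tmul, LinearMap.comp_apply]
    generalize ρV (f w) = s
    induction s with
    | zero => simp
    | add x y hx hy => simp only [TensorProduct.add_tmul, map_add, hx, hy]
    | tmul v h =>
      simp only [LinearMap.lTensor_tmul, TensorProduct.assoc_tmul, hμ.comul,
        LinearMap.comp_apply, LinearEquiv.coe_coe, LinearMap.rTensor_tmul,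
        LinearEquiv.apply_symm_apply]

lemma ratHom_range (hμ : IsCoalgTwist μ)
    (hW : ∀ m, TensorProduct.assoc k W H H (ρW.rTensor H (ρW m)) =
        (comul (R := k) (A := H)).lTensor W (ρW m))
    (hV : ∀ m, TensorProduct.assoc k V H H (ρV.rTensor H (ρV m)) =
        (comul (R := k) (A := H)).lTensor V (ρV m))
    (f : W →ₗ[k] V) (z : (W →ₗ[k] V) ⊗[k] H)
    (hz : can k W V H z = homCoact μ ρW ρV f) :
    z ∈ LinearMap.range ((ratHom μ ρW ρV).subtype.rTensor H) := by
  refine mem_range_of_contract _ z fun c => ?_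
  refine ⟨(contract c ∘ₗ comul).lTensor _ z, ?_⟩
  ext w
  have h1 : ∀ t : (W →ₗ[k] V) ⊗[k] H, homCoact μ ρW ρV (contract c t) w =
      contract c (can k W (V ⊗[k] H) H ((homCoact μ ρW ρV).rTensor H t) w) := by
    intro t
    induction t with
    | zero => simp
    | add x y hx hy => simp only [map_add, LinearMap.add_apply, hx, hy]
    | tmul f h => simp
  have h2 : ∀ t : (W →ₗ[k] V) ⊗[k] H, can k W V H ((contract c ∘ₗ comul).lTensor _ t) w =
      contract c ((TensorProduct.assoc k V H H).symm
        ((comul (R := k) (A := H)).lTensor V (can k W V H t w))) := by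
    intro t
    induction t with
    | zero => simp
    | add x y hx hy => simp only [map_add, LinearMap.add_apply, hx, hy]
    | tmul f h =>
      simp only [LinearMap.lTensor_tmul, can_tmul, LinearMap.comp_apply]
      generalize (comul (R := k) h : H ⊗[k] H) = s
      induction s with
      | zero => simp
      | add x y hx hy => simp only [TensorProduct.tmul_add, map_add, hx, hy]
      | tmul a b => simp
  rw [h1, h2, homCoactAux_can, hz, homCoactAux_homCoact hμ hW hV]

/-- `Hom(W, V)' ⊗ Q → Hom(W, V ⊗ Q)` for the subspace `Hom(W, V)'` of rational maps. -/
noncomputable def ratCan (μ : H ⊗[k] H →ₗ[k] H) (ρW : W →ₗ[k] W ⊗[k] H) (ρV : V →ₗ[k] V ⊗[k] H)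
    (Q : Type u) [AddCommGroup Q] [Module k Q] :
    ratHom μ ρW ρV ⊗[k] Q →ₗ[k] (W →ₗ[k] V ⊗[k] Q) :=
  can k W V Q ∘ₗ (ratHom μ ρW ρV).subtype.rTensor Q

@[simp] lemma ratCan_tmul {Q : Type u} [AddCommGroup Q] [Module k Q] (f : ratHom μ ρW ρV) (q : Q)
    (w : W) : ratCan μ ρW ρV Q (f ⊗ₜ q) w = f.1 w ⊗ₜ q := rfl

lemma ratCan_injective (Q : Type u) [AddCommGroup Q] [Module k Q] :
    Function.Injective (ratCan μ ρW ρV Q) :=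
  (can_injective Q).comp
    (Module.Flat.rTensor_preserves_injective_linearMap _ (Submodule.injective_subtype _))

lemma homCoact_mem_range (hμ : IsCoalgTwist μ)
    (hW : ∀ m, TensorProduct.assoc k W H H (ρW.rTensor H (ρW m)) =
        (comul (R := k) (A := H)).lTensor W (ρW m))
    (hV : ∀ m, TensorProduct.assoc k V H H (ρV.rTensor H (ρV m)) =
        (comul (R := k) (A := H)).lTensor V (ρV m))
    (f : ratHom μ ρW ρV) :
    homCoact μ ρW ρV f.1 ∈ LinearMap.range (ratCan μ ρW ρV H) := by
  obtain ⟨z, hz⟩ := f.2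
  obtain ⟨y, rfl⟩ := ratHom_range hμ hW hV f.1 z hz
  exact ⟨y, hz⟩

/-- The coaction on the rational maps, i.e. the corestriction of `homCoact`. -/
noncomputable def ratCoact (hμ : IsCoalgTwist μ)
    (hW : ∀ m, TensorProduct.assoc k W H H (ρW.rTensor H (ρW m)) =
        (comul (R := k) (A := H)).lTensor W (ρW m))
    (hV : ∀ m, TensorProduct.assoc k V H H (ρV.rTensor H (ρV m)) =
        (comul (R := k) (A := H)).lTensor V (ρV m))
    : ratHom μ ρW ρV →ₗ[k] ratHom μ ρW ρV ⊗[k] H :=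
  (LinearEquiv.ofInjective (ratCan μ ρW ρV H) (ratCan_injective H)).symm.toLinearMap ∘ₗ
    (homCoact μ ρW ρV ∘ₗ (ratHom μ ρW ρV).subtype).codRestrict (LinearMap.range (ratCan μ ρW ρV H))
      (homCoact_mem_range hμ hW hV)

lemma ratCan_ratCoact (hμ : IsCoalgTwist μ)
    (hW : ∀ m, TensorProduct.assoc k W H H (ρW.rTensor H (ρW m)) =
        (comul (R := k) (A := H)).lTensor W (ρW m))
    (hV : ∀ m, TensorProduct.assoc k V H H (ρV.rTensor H (ρV m)) =
        (comul (R := k) (A := H)).lTensor V (ρV m))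
    (f : ratHom μ ρW ρV) :
    ratCan μ ρW ρV H (ratCoact hμ hW hV f) = homCoact μ ρW ρV f.1 :=
  congrArg Subtype.val ((LinearEquiv.ofInjective (ratCan μ ρW ρV H)
    (ratCan_injective H)).apply_symm_apply ⟨homCoact μ ρW ρV f.1, homCoact_mem_range hμ hW hV f⟩)

lemma ratCoact_eq (hμ : IsCoalgTwist μ)
    (hW : ∀ m, TensorProduct.assoc k W H H (ρW.rTensor H (ρW m)) =
        (comul (R := k) (A := H)).lTensor W (ρW m))
    (hV : ∀ m, TensorProduct.assoc k V H H (ρV.rTensor H (ρV m)) =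
        (comul (R := k) (A := H)).lTensor V (ρV m))
    {f : ratHom μ ρW ρV} {z : ratHom μ ρW ρV ⊗[k] H}
    (h : ratCan μ ρW ρV H z = homCoact μ ρW ρV f.1) : ratCoact hμ hW hV f = z :=
  ratCan_injective H ((ratCan_ratCoact hμ hW hV f).trans h.symm)

lemma ratCoact_coassoc (hμ : IsCoalgTwist μ)
    (hW : ∀ m, TensorProduct.assoc k W H H (ρW.rTensor H (ρW m)) =
        (comul (R := k) (A := H)).lTensor W (ρW m))
    (hV : ∀ m, TensorProduct.assoc k V H H (ρV.rTensor H (ρV m)) =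
        (comul (R := k) (A := H)).lTensor V (ρV m))
    (f : ratHom μ ρW ρV) :
    TensorProduct.assoc k (ratHom μ ρW ρV) H H
      ((ratCoact hμ hW hV).rTensor H (ratCoact hμ hW hV f)) =
      (comul (R := k) (A := H)).lTensor (ratHom μ ρW ρV) (ratCoact hμ hW hV f) := by
  apply ratCan_injective (H ⊗[k] H)
  ext w
  have h1 : ∀ t : ratHom μ ρW ρV ⊗[k] H, ratCan μ ρW ρV (H ⊗[k] H)
      (TensorProduct.assoc k _ H H ((ratCoact hμ hW hV).rTensor H t)) w =
      TensorProduct.assoc k V H H (can k W (V ⊗[k] H) H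
        ((homCoact μ ρW ρV).rTensor H ((ratHom μ ρW ρV).subtype.rTensor H t)) w) := by
    intro t
    induction t with
    | zero => simp
    | add x y hx hy => simp only [map_add, LinearMap.add_apply, hx, hy]
    | tmul f h =>
      simp only [LinearMap.rTensor_tmul, can_tmul, Submodule.subtype_apply]
      rw [← ratCan_ratCoact hμ hW hV]
      generalize ratCoact hμ hW hV f = s
      induction s with
      | zero => simp
      | add x y hx hy =>
        simp only [map_add, TensorProduct.add_tmul, LinearMap.add_apply, hx, hy]
      | tmul f x => simp
  have h2 : ∀ t : ratHom μ ρW ρV ⊗[k] H, ratCan μ ρW ρV (H ⊗[k] H)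
      ((comul (R := k) (A := H)).lTensor (ratHom μ ρW ρV) t) w =
      (comul (R := k) (A := H)).lTensor V (ratCan μ ρW ρV H t w) := by
    intro t
    induction t with
    | zero => simp
    | add x y hx hy => simp only [map_add, LinearMap.add_apply, hx, hy]
    | tmul f h =>
      simp only [LinearMap.lTensor_tmul, ratCan_tmul]
  rw [h1, h2, homCoactAux_can]
  change TensorProduct.assoc k V H H (homCoactAux μ ρV
    ((ratCan μ ρW ρV H (ratCoact hμ hW hV f)).rTensor H (ρW w))) = _
  rw [ratCan_ratCoact, homCoactAux_homCoact hμ hW hV, LinearEquiv.apply_symm_apply]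

lemma ratCoact_counit (hμ : IsCoalgTwist μ)
    (hW : ∀ m, TensorProduct.assoc k W H H (ρW.rTensor H (ρW m)) =
        (comul (R := k) (A := H)).lTensor W (ρW m))
    (hV : ∀ m, TensorProduct.assoc k V H H (ρV.rTensor H (ρV m)) =
        (comul (R := k) (A := H)).lTensor V (ρV m))
    (hW' : ∀ m, TensorProduct.rid k W ((counit (R := k) (A := H)).lTensor W (ρW m)) = m)
    (hV' : ∀ m, TensorProduct.rid k V ((counit (R := k) (A := H)).lTensor V (ρV m)) = m)
    (f : ratHom μ ρW ρV) :
    TensorProduct.rid k (ratHom μ ρW ρV)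
      ((counit (R := k) (A := H)).lTensor _ (ratCoact hμ hW hV f)) = f := by
  apply Subtype.ext
  ext w
  have h1 : ∀ t : ratHom μ ρW ρV ⊗[k] H, (TensorProduct.rid k (ratHom μ ρW ρV)
      ((counit (R := k) (A := H)).lTensor _ t)).1 w = contract counit (ratCan μ ρW ρV H t w) := by
    intro t
    induction t with
    | zero => simp
    | add x y hx hy => simp only [map_add, LinearMap.add_apply, Submodule.coe_add, hx, hy]
    | tmul f h => simp
  rw [h1, ratCan_ratCoact, homCoact_apply]
  have h2 : ∀ t : W ⊗[k] H, contract counit (μ.lTensor V (TensorProduct.assoc k V H H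
      ((ρV ∘ₗ f.1).rTensor H t))) = f.1 (contract counit t) := by
    intro t
    induction t with
    | zero => simp
    | add x y hx hy => simp only [map_add, hx, hy]
    | tmul w x =>
      have h3 : ∀ s : V ⊗[k] H, contract counit (μ.lTensor V (TensorProduct.assoc k V H H
          (s ⊗ₜ x))) = counit (R := k) x • contract counit s := by
        intro s
        induction s with
        | zero => simp
        | add x y hx hy => simp only [TensorProduct.add_tmul, map_add, smul_add, hx, hy]
        | tmul v h => simp [hμ.counit, smul_smul, mul_comm]
      rw [LinearMap.rTensor_tmul, h3, contract_tmul, map_smul]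
      congr 1
      exact hV' (f.1 w)
  rw [h2]
  exact congrArg f.1 (hW' w)

end

section
variable {μ : H ⊗[k] H →ₗ[k] H} {ρW : W →ₗ[k] W ⊗[k] H} {ρV : V →ₗ[k] V ⊗[k] H}
  {ρV' : V' →ₗ[k] V' ⊗[k] H}

lemma homCoact_comp (θ : V →ₗ[k] V') (hθ : ∀ v, ρV' (θ v) = θ.rTensor H (ρV v)) (f : W →ₗ[k] V) :
    homCoact μ ρW ρV' (θ ∘ₗ f) = θ.rTensor H ∘ₗ homCoact μ ρW ρV f := by
  ext w
  simp only [LinearMap.comp_apply, homCoact_apply]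
  generalize ρW w = t
  induction t with
  | zero => simp
  | add x y hx hy => simp only [map_add, hx, hy]
  | tmul w x =>
    simp only [LinearMap.rTensor_tmul, LinearMap.comp_apply, hθ]
    generalize ρV (f w) = s
    induction s with
    | zero => simp
    | add x y hx hy => simp only [map_add, TensorProduct.add_tmul, hx, hy]
    | tmul v y => simp

/-- `θ ∘ -` on rational maps. -/
noncomputable def ratMap (θ : V →ₗ[k] V') (hθ : ∀ v, ρV' (θ v) = θ.rTensor H (ρV v)) :
    ratHom μ ρW ρV →ₗ[k] ratHom μ ρW ρV' :=
  (LinearMap.llcomp k W V V' θ).restrict fun f hf => by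
    obtain ⟨z, hz⟩ := hf
    refine ⟨(LinearMap.llcomp k W V V' θ).rTensor H z, ?_⟩
    change _ = homCoact μ ρW ρV' (θ ∘ₗ f)
    rw [homCoact_comp θ hθ, ← hz]
    ext w
    generalize z = t
    induction t with
    | zero => simp
    | add x y hx hy => simp only [map_add, LinearMap.add_apply, LinearMap.comp_add, hx, hy]
    | tmul w x => simp

@[simp] lemma ratMap_coe (θ : V →ₗ[k] V') (hθ : ∀ v, ρV' (θ v) = θ.rTensor H (ρV v))
    (f : ratHom μ ρW ρV) : (ratMap θ hθ f).1 = θ ∘ₗ f.1 := rfl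

lemma ratCan_ratMap (θ : V →ₗ[k] V') (hθ : ∀ v, ρV' (θ v) = θ.rTensor H (ρV v))
    (z : ratHom μ ρW ρV ⊗[k] H) :
    ratCan μ ρW ρV' H ((ratMap θ hθ).rTensor H z) = θ.rTensor H ∘ₗ ratCan μ ρW ρV H z := by
  ext w
  induction z with
  | zero => simp
  | add x y hx hy => simp only [map_add, LinearMap.add_apply, LinearMap.comp_add, hx, hy]
  | tmul f x => simp

end

end
end Coaction

namespace Coaction

section
variable {k H : Type u} [Field k] [Ring H] [HopfAlgebra k H]
variable {T W V : Type u} [AddCommGroup T] [Module k T] [AddCommGroup W] [Module k W]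
  [AddCommGroup V] [Module k V]
  {ρT : T →ₗ[k] T ⊗[k] H} {ρW : W →ₗ[k] W ⊗[k] H} {ρV : V →ₗ[k] V ⊗[k] H}

lemma can_lift_mul (φ : T →ₗ[k] W →ₗ[k] V) (t : T) (w : W) :
    twist (LinearMap.mul' k H) ρW (can k W V H (φ.rTensor H (ρT t))) w =
      (TensorProduct.lift φ).rTensor H (tensor ρT ρW (t ⊗ₜ w)) := by
  simp only [tensor_tmul, twist, LinearMap.comp_apply, LinearEquiv.coe_coe]
  generalize ρT t = s
  generalize ρW w = r
  induction s with
  | zero => simp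
  | add x y hx hy =>
    simp only [map_add, TensorProduct.add_tmul, LinearMap.rTensor_add, LinearMap.add_apply, hx, hy]
  | tmul t x =>
    induction r with
    | zero => simp
    | add x y hx hy => simp only [map_add, TensorProduct.tmul_add, hx, hy]
    | tmul w y => simp

lemma can_lift_mulOp (φ : T →ₗ[k] W →ₗ[k] V) (t : T) (w : W) :
    twist (mulOp k H) ρW (can k W V H (φ.rTensor H (ρT t))) w =
      (TensorProduct.lift φ.flip).rTensor H (tensor ρW ρT (w ⊗ₜ t)) := by
  simp only [tensor_tmul, twist, LinearMap.comp_apply, LinearEquiv.coe_coe]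
  generalize ρT t = s
  generalize ρW w = r
  induction s with
  | zero => simp
  | add x y hx hy =>
    simp only [map_add, TensorProduct.tmul_add, LinearMap.rTensor_add, LinearMap.add_apply, hx, hy]
  | tmul t x =>
    induction r with
    | zero => simp
    | add x y hx hy => simp only [map_add, TensorProduct.add_tmul, hx, hy]
    | tmul w y => simp [mulOp]

lemma homCoact_eq_iff {ν μ : H ⊗[k] H →ₗ[k] H} (h₁ : IsLeftInv ν μ) (h₂ : IsLeftInv μ ν)
    (hW : ∀ m, TensorProduct.assoc k W H H (ρW.rTensor H (ρW m)) =
      (comul (R := k) (A := H)).lTensor W (ρW m))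
    (hW' : ∀ m, TensorProduct.rid k W ((counit (R := k) (A := H)).lTensor W (ρW m)) = m)
    (f : W →ₗ[k] V) (G : W →ₗ[k] V ⊗[k] H) :
    homCoact μ ρW ρV f = G ↔ ρV ∘ₗ f = twist ν ρW G := by
  constructor
  · rintro rfl
    exact (twist_twist h₁ ρW hW hW' _).symm
  · intro h
    change twist μ ρW (ρV ∘ₗ f) = G
    rw [h, twist_twist h₂ ρW hW hW']

lemma lift_comm_iff
    (hW : ∀ m, TensorProduct.assoc k W H H (ρW.rTensor H (ρW m)) =
      (comul (R := k) (A := H)).lTensor W (ρW m))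
    (hW' : ∀ m, TensorProduct.rid k W ((counit (R := k) (A := H)).lTensor W (ρW m)) = m)
    (φ : T →ₗ[k] W →ₗ[k] V) :
    (∀ x, ρV (TensorProduct.lift φ x) = (TensorProduct.lift φ).rTensor H (tensor ρT ρW x)) ↔
      ∀ t, homCoact (mulS k H) ρW ρV (φ t) = can k W V H (φ.rTensor H (ρT t)) := by
  simp only [homCoact_eq_iff mul_mulS mulS_mul hW hW', LinearMap.ext_iff, can_lift_mul]
  refine ⟨fun h t w => h (t ⊗ₜ w), fun h x => ?_⟩
  induction x with
  | zero => simp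
  | add x y hx hy => simp only [map_add, hx, hy]
  | tmul t w => exact h t w

lemma lift_flip_comm_iff [BijectiveAntipode k H]
    (hW : ∀ m, TensorProduct.assoc k W H H (ρW.rTensor H (ρW m)) =
      (comul (R := k) (A := H)).lTensor W (ρW m))
    (hW' : ∀ m, TensorProduct.rid k W ((counit (R := k) (A := H)).lTensor W (ρW m)) = m)
    (φ : T →ₗ[k] W →ₗ[k] V) :
    (∀ x, ρV (TensorProduct.lift φ.flip x) =
      (TensorProduct.lift φ.flip).rTensor H (tensor ρW ρT x)) ↔
      ∀ t, homCoact (mulSInv k H) ρW ρV (φ t) = can k W V H (φ.rTensor H (ρT t)) := by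
  simp only [homCoact_eq_iff mulOp_mulSInv mulSInv_mulOp hW hW', LinearMap.ext_iff, can_lift_mulOp]
  refine ⟨fun h t w => h (w ⊗ₜ t), fun h x => ?_⟩
  induction x with
  | zero => simp
  | add x y hx hy => simp only [map_add, hx, hy]
  | tmul w t => exact h t w

end
end Coaction

namespace Comod

section
variable {k H : Type u} [Field k] [Ring H] [HopfAlgebra k H]

/-- The comodule of maps `f : W → V` with `ρ f ∈ Hom(W, V) ⊗ H`, where
`ρ f (w) = f(w₀)₀ ⊗ μ(f(w₀)₁ ⊗ w₁)`, and with the coaction `ρ`. -/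
noncomputable abbrev ratHom (μ : H ⊗[k] H →ₗ[k] H) (hμ : Coaction.IsCoalgTwist μ) (W V : Comod k H) :
    Comod k H where
  carrier := Coaction.ratHom μ W.coact V.coact
  coact := Coaction.ratCoact hμ W.coassoc V.coassoc
  coassoc := Coaction.ratCoact_coassoc hμ W.coassoc V.coassoc
  counit_coact := Coaction.ratCoact_counit hμ W.coassoc V.coassoc W.counit_coact V.counit_coact

/-- `Hom(W, -)` as a functor, acting by postcomposition. -/
noncomputable def ratHomFunctor (μ : H ⊗[k] H →ₗ[k] H) (hμ : Coaction.IsCoalgTwist μ)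
    (W : Comod k H) : Comod k H ⥤ Comod k H where
  obj V := ratHom μ hμ W V
  map {V V'} θ := mkHom (M := ratHom μ hμ W V) (N := ratHom μ hμ W V')
    (Coaction.ratMap (lin θ) (coact_lin θ)) fun f => by
      refine Coaction.ratCoact_eq hμ W.coassoc V'.coassoc ?_
      rw [Coaction.ratCan_ratMap, Coaction.ratCan_ratCoact, Coaction.ratMap_coe,
        Coaction.homCoact_comp _ (coact_lin θ)]
  map_id _ := rfl
  map_comp _ _ := rfl

/-- A linear map `φ : T → Hom(W, V)` with `ρ(φ t) = φ(t₀) ⊗ t₁` as a comodule morphism. -/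
noncomputable def mkRat {μ : H ⊗[k] H →ₗ[k] H} {hμ : Coaction.IsCoalgTwist μ} {T W V : Comod k H}
    (φ : T.carrier →ₗ[k] W.carrier →ₗ[k] V.carrier)
    (hφ : ∀ t, Coaction.homCoact μ W.coact V.coact (φ t) =
      Coaction.can k W.carrier V.carrier H (φ.rTensor H (T.coact t))) :
    T ⟶ ratHom μ hμ W V :=
  mkHom (N := ratHom μ hμ W V) (φ.codRestrict _ fun t => ⟨_, (hφ t).symm⟩) fun t => by
    refine Coaction.ratCoact_eq hμ W.coassoc V.coassoc ?_
    rw [Coaction.ratCan, LinearMap.comp_apply, ← LinearMap.rTensor_comp_apply]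
    exact (hφ t).symm

/-- The linear map `T → Hom(W, V)` underlying a comodule morphism. -/
noncomputable def unRat {μ : H ⊗[k] H →ₗ[k] H} {hμ : Coaction.IsCoalgTwist μ} {T W V : Comod k H}
    (f : T ⟶ ratHom μ hμ W V) : T.carrier →ₗ[k] W.carrier →ₗ[k] V.carrier :=
  (Coaction.ratHom μ W.coact V.coact).subtype ∘ₗ lin f

lemma unRat_spec {μ : H ⊗[k] H →ₗ[k] H} {hμ : Coaction.IsCoalgTwist μ} {T W V : Comod k H}
    (f : T ⟶ ratHom μ hμ W V) (t : T.carrier) : Coaction.homCoact μ W.coact V.coact (unRat f t) =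
      Coaction.can k W.carrier V.carrier H ((unRat f).rTensor H (T.coact t)) := by
  change Coaction.homCoact μ W.coact V.coact (lin f t).1 = _
  rw [← Coaction.ratCan_ratCoact hμ W.coassoc V.coassoc]
  change Coaction.ratCan _ _ _ _ ((ratHom μ hμ W V).coact (lin f t)) = _
  rw [coact_lin, Coaction.ratCan, LinearMap.comp_apply, ← LinearMap.rTensor_comp_apply]
  rfl

/-- `Homˡ(W, -)`: the maps `f : W → V` with `ρˡ f ∈ Hom(W, V) ⊗ H`, with the coaction
`ρˡ f (w) = f(w₀)₀ ⊗ f(w₀)₁ S(w₁)`. -/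
noncomputable def homL (W : Comod k H) : Comod k H ⥤ Comod k H :=
  ratHomFunctor (Coaction.mulS k H) Coaction.isCoalgTwist_mulS W

/-- `Homʳ(W, -)`: the maps `f : W → V` with `ρʳ f ∈ Hom(W, V) ⊗ H`, with the coaction
`ρʳ f (w) = f(w₀)₀ ⊗ S⁻¹(w₁) f(w₀)₁`. -/
noncomputable def homR [BijectiveAntipode k H] (W : Comod k H) : Comod k H ⥤ Comod k H :=
  ratHomFunctor (Coaction.mulSInv k H) Coaction.isCoalgTwist_mulSInv W

/-- The linear map `W → M` given by an element of `Homˡ(W, M)`. -/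
noncomputable def homLVal {W M : Comod k H} (f : ((homL W).obj M).carrier) :
    W.carrier →ₗ[k] M.carrier :=
  Subtype.val (p := (· ∈ Coaction.ratHom (Coaction.mulS k H) W.coact M.coact)) f

/-- The linear map `W → M` given by an element of `Homʳ(W, M)`. -/
noncomputable def homRVal [BijectiveAntipode k H] {W M : Comod k H}
    (f : ((homR W).obj M).carrier) : W.carrier →ₗ[k] M.carrier :=
  Subtype.val (p := (· ∈ Coaction.ratHom (Coaction.mulSInv k H) W.coact M.coact)) f

lemma lift_curry {A B D : Type u} [AddCommGroup A] [Module k A] [AddCommGroup B] [Module k B]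
    [AddCommGroup D] [Module k D] (f : A ⊗[k] B →ₗ[k] D) :
    TensorProduct.lift (TensorProduct.curry f) = f :=
  TensorProduct.ext' fun _ _ => rfl

/-- `Hom(T ⊗ W, V)ᴴ ≃ Hom(T, Homˡ(W, V))ᴴ`, `f ↦ (t ↦ f(t ⊗ -))`. -/
noncomputable def homLEquiv (T W V : Comod k H) : (T ⊗ W ⟶ V) ≃ (T ⟶ (homL W).obj V) where
  toFun f := mkRat (TensorProduct.curry (lin f))
    ((Coaction.lift_comm_iff W.coassoc W.counit_coact _).1
      (by rw [lift_curry]; exact coact_lin f))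
  invFun g := mkHom (M := tensor T W) (TensorProduct.lift (unRat g))
    ((Coaction.lift_comm_iff W.coassoc W.counit_coact _).2 (unRat_spec g))
  left_inv f := hom_ext (TensorProduct.ext' fun _ _ => rfl)
  right_inv g := rfl

/-- `Hom(W ⊗ T, V)ᴴ ≃ Hom(T, Homʳ(W, V))ᴴ`, `f ↦ (t ↦ f(- ⊗ t))`. -/
noncomputable def homREquiv [BijectiveAntipode k H] (T W V : Comod k H) :
    (W ⊗ T ⟶ V) ≃ (T ⟶ (homR W).obj V) where
  toFun f := mkRat (TensorProduct.curry (lin f)).flip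
    ((Coaction.lift_flip_comm_iff W.coassoc W.counit_coact _).1
      (by rw [LinearMap.flip_flip, lift_curry]; exact coact_lin f))
  invFun g := mkHom (M := tensor W T) (TensorProduct.lift (unRat g).flip)
    ((Coaction.lift_flip_comm_iff W.coassoc W.counit_coact _).2 (unRat_spec g))
  left_inv f := hom_ext (TensorProduct.ext' fun _ _ => rfl)
  right_inv g := rfl

end
end Comod

/-! ### Biclosed monoidal categories and the center of the opposite bimodule category -/

/-- A biclosed monoidal category: left internal Homs with
`Hom(T ⊗ W, V) ≃ Hom(T, Homˡ(W, V))` and right internal Homs with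
`Hom(W ⊗ T, V) ≃ Hom(T, Homʳ(W, V))`. -/
class BiclosedCategory (C : Type*) [Category C] [MonoidalCategory C] where
  /-- `Homˡ(W, -)` -/
  homL : C → C ⥤ C
  adjL : ∀ W : C, tensorRight W ⊣ homL W
  /-- `Homʳ(W, -)` -/
  homR : C → C ⥤ C
  adjR : ∀ W : C, tensorLeft W ⊣ homR W

noncomputable instance (k H : Type u) [Field k] [Ring H] [HopfAlgebra k H]
    [BijectiveAntipode k H] : BiclosedCategory (Comod k H) where
  homL := Comod.homL
  adjL W := Adjunction.mkOfHomEquiv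
    { homEquiv := fun T V => Comod.homLEquiv T W V
      homEquiv_naturality_left_symm := fun _ _ =>
        Comod.hom_ext (TensorProduct.ext' fun _ _ => rfl)
      homEquiv_naturality_right := fun _ _ => rfl }
  homR := Comod.homR
  adjR W := Adjunction.mkOfHomEquiv
    { homEquiv := fun T V => Comod.homREquiv T W V
      homEquiv_naturality_left_symm := fun _ _ =>
        Comod.hom_ext (TensorProduct.ext' fun _ _ => rfl)
      homEquiv_naturality_right := fun _ _ => rfl }

namespace BiclosedCategory

section
universe v w
variable {C : Type w} [Category.{v} C] [MonoidalCategory C] [BiclosedCategory C]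

/-- `W ▷ M = Homˡ(W, M)`, the left action of `C` on `Cᵒᵖ`. -/
abbrev actL (W M : C) : C := (homL W).obj M

/-- `M ◁ W = Homʳ(W, M)`, the right action of `C` on `Cᵒᵖ`. -/
abbrev actR (M W : C) : C := (homR W).obj M

/-- `Hom(T ⊗ W, M) ≃ Hom(T, W ▷ M)` -/
def curL (T W M : C) : (T ⊗ W ⟶ M) ≃ (T ⟶ actL W M) := (adjL W).homEquiv T M

/-- `Hom(W ⊗ T, M) ≃ Hom(T, M ◁ W)` -/
def curR (T W M : C) : (W ⊗ T ⟶ M) ≃ (T ⟶ actR M W) := (adjR W).homEquiv T M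

/-- evaluation `(W ▷ M) ⊗ W ⟶ M` -/
def evL (W M : C) : actL W M ⊗ W ⟶ M := (curL _ W M).symm (𝟙 _)

/-- evaluation `W ⊗ (M ◁ W) ⟶ M` -/
def evR (W M : C) : W ⊗ actR M W ⟶ M := (curR _ W M).symm (𝟙 _)

/-- `W ▷ M ⟶ W' ▷ M` for `φ : W' ⟶ W` -/
def preL {W' W : C} (φ : W' ⟶ W) (M : C) : actL W M ⟶ actL W' M :=
  curL _ W' M ((actL W M ◁ φ) ≫ evL W M)

/-- `M ◁ W ⟶ M ◁ W'` for `φ : W' ⟶ W` -/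
def preR {W' W : C} (φ : W' ⟶ W) (M : C) : actR M W ⟶ actR M W' :=
  curR _ W' M ((φ ▷ actR M W) ≫ evR W M)

/-- the canonical map `(W ⊗ V) ▷ M ⟶ W ▷ (V ▷ M)` -/
def assocL (W V M : C) : actL (W ⊗ V) M ⟶ actL W (actL V M) :=
  curL _ W _ (curL _ V M ((α_ _ W V).hom ≫ evL (W ⊗ V) M))

/-- the canonical map `W ▷ (M ◁ V) ⟶ (W ▷ M) ◁ V` -/
def assocM (W V M : C) : actL W (actR M V) ⟶ actR (actL W M) V :=
  curR _ V _ (curL _ W M ((α_ V _ W).hom ≫ (V ◁ evL W (actR M V)) ≫ evR V M))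

/-- the canonical map `(M ◁ W) ◁ V ⟶ M ◁ (W ⊗ V)` -/
def assocR (W V M : C) : actR (actR M W) V ⟶ actR M (W ⊗ V) :=
  curR _ (W ⊗ V) M ((α_ W V _).hom ≫ (W ◁ evR V (actR M W)) ≫ evR W M)

/-- the canonical map `M ⟶ 1 ▷ M` -/
def unitL (M : C) : M ⟶ actL (𝟙_ C) M := curL _ _ M (ρ_ M).hom

/-- the canonical map `M ⟶ M ◁ 1` -/
def unitR (M : C) : M ⟶ actR M (𝟙_ C) := curR _ _ M (λ_ M).hom

end
end BiclosedCategory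

open BiclosedCategory in
/-- Objects of the center of the opposite bimodule category: an object `M` with
isomorphisms `τ_W : W ▷ M ≅ M ◁ W`, natural in `W` and compatible with `⊗` and with the unit. -/
structure OpCenter (C : Type*) [Category C] [MonoidalCategory C] [BiclosedCategory C] where
  obj : C
  τ : ∀ W : C, actL W obj ≅ actR obj W
  natural : ∀ {W' W : C} (φ : W' ⟶ W), (τ W).hom ≫ preR φ obj = preL φ obj ≫ (τ W').hom
  assoc : ∀ W V : C, (τ (W ⊗ V)).hom = assocL W V obj ≫ (homL W).map (τ V).hom ≫
    assocM W V obj ≫ (homR V).map (τ W).hom ≫ assocR W V obj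
  unit : unitL obj ≫ (τ (𝟙_ C)).hom = unitR obj

namespace OpCenter

section
universe v w
variable {C : Type w} [Category.{v} C] [MonoidalCategory C] [BiclosedCategory C]
open BiclosedCategory

/-- Morphisms `M ⟶ N` of `C` that commute with the central structures. -/
@[ext] structure Hom (M N : OpCenter C) where
  hom : M.obj ⟶ N.obj
  comm : ∀ W : C, (M.τ W).hom ≫ (homR W).map hom = (homL W).map hom ≫ (N.τ W).hom

instance : Category (OpCenter C) where
  Hom := Hom
  id M := ⟨𝟙 _, fun W => by simp⟩
  comp f g := ⟨f.hom ≫ g.hom, fun W => by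
    rw [Functor.map_comp, Functor.map_comp, ← Category.assoc, f.comm, Category.assoc, g.comm,
      Category.assoc]⟩

/-- The functor that forgets the central structure. -/
def forget (C : Type w) [Category.{v} C] [MonoidalCategory C] [BiclosedCategory C] :
    OpCenter C ⥤ C where
  obj M := M.obj
  map f := f.hom

/-- `Hom(M, M) ≃ Hom(1, M ▷ M) ≃ Hom(1, M ◁ M) ≃ Hom(M, M)` -/
def endMap (M : OpCenter C) (f : M.obj ⟶ M.obj) : M.obj ⟶ M.obj :=
  (ρ_ M.obj).inv ≫ (curR _ _ _).symm (curL _ _ _ ((λ_ M.obj).hom ≫ f) ≫ (M.τ M.obj).hom)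

/-- The central structure fixes the identity map. -/
def FixesId : ObjectProperty (OpCenter C) := fun M => M.endMap (𝟙 M.obj) = 𝟙 M.obj

end
end OpCenter

/-! ### Symmetric 2-contratraces -/

open Opposite in
/-- A symmetric 2-contratrace: a contravariant functor `F` to `k`-vector spaces
with natural isomorphisms `ι : F(V ⊗ W) ≅ F(W ⊗ V)` that are compatible with `⊗` and symmetric. (Given `hexagon`,
the condition `symm` says that `ι 1 V : F(1 ⊗ V) ≅ F(V ⊗ 1)` is the identity of `F(V)`.) -/
structure SymmContratrace (k : Type*) [Field k] (C : Type*) [Category.{u} C]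
    [MonoidalCategory C] where
  F : Cᵒᵖ ⥤ ModuleCat.{u} k
  ι : ∀ V W : C, F.obj (op (V ⊗ W)) ≅ F.obj (op (W ⊗ V))
  natural : ∀ {V' V W' W : C} (f : V' ⟶ V) (g : W' ⟶ W),
    (ι V W).hom ≫ F.map (g ⊗ₘ f).op = F.map (f ⊗ₘ g).op ≫ (ι V' W').hom
  hexagon : ∀ U V W : C, (ι U (V ⊗ W)).hom =
    F.map (α_ U V W).hom.op ≫ (ι (U ⊗ V) W).hom ≫ F.map (α_ W U V).hom.op ≫
      (ι (W ⊗ U) V).hom ≫ F.map (α_ V W U).hom.op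
  symm : ∀ V W : C, (ι V W).hom ≫ (ι W V).hom = 𝟙 _

namespace SymmContratrace

section
universe w
variable {k : Type*} [Field k] {C : Type w} [Category.{u} C] [MonoidalCategory C]
open Opposite

/-- Natural transformations that commute with the symmetries. -/
@[ext] structure Hom (F G : SymmContratrace k C) where
  nat : F.F ⟶ G.F
  comm : ∀ V W : C, (F.ι V W).hom ≫ nat.app (op (W ⊗ V)) = nat.app (op (V ⊗ W)) ≫ (G.ι V W).hom

instance : Category (SymmContratrace k C) where
  Hom := Hom
  id F := ⟨𝟙 _, fun V W => by simp⟩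
  comp f g := ⟨f.nat ≫ g.nat, fun V W => by
    rw [NatTrans.comp_app, NatTrans.comp_app, ← Category.assoc, f.comm, Category.assoc, g.comm,
      Category.assoc]⟩

/-- The underlying contravariant functor. -/
def forget (k : Type*) [Field k] (C : Type w) [Category.{u} C] [MonoidalCategory C] :
    SymmContratrace k C ⥤ Cᵒᵖ ⥤ ModuleCat.{u} k where
  obj F := F.F
  map f := f.nat

/-- `F ≅ Hom(-, M)` for some `M`. -/
def Representable [Preadditive C] [Linear k C] : ObjectProperty (SymmContratrace k C) :=
  fun F => ∃ M : C, Nonempty (F.F ≅ (linearYoneda k C).obj M)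

end
end SymmContratrace

/-! ### Anti-Yetter-Drinfeld modules -/

/-- For `h₁ ⊗ (h₂ ⊗ h₃)` this is the map `m ⊗ x ↦ h₂ m ⊗ h₃ x S(h₁)`. -/
noncomputable def aydMap {k H M : Type u} [Field k] [Ring H] [HopfAlgebra k H] [AddCommGroup M]
    [Module k M] (act : H →ₐ[k] Module.End k M) :
    H ⊗[k] (H ⊗[k] H) →ₗ[k] Module.End k (M ⊗[k] H) :=
  LinearMap.mul' k (Module.End k (M ⊗[k] H)) ∘ₗ TensorProduct.map
    (LinearMap.lTensorHom M ∘ₗ (LinearMap.mul k H).flip ∘ₗ HopfAlgebra.antipode k)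
    (TensorProduct.homTensorHomMap (RingHom.id k) M H M H ∘ₗ
      TensorProduct.map act.toLinearMap (LinearMap.mul k H))

lemma aydMap_tmul {k H M : Type u} [Field k] [Ring H] [HopfAlgebra k H] [AddCommGroup M]
    [Module k M] (act : H →ₐ[k] Module.End k M) (h₁ h₂ h₃ x : H) (m : M) :
    aydMap act (h₁ ⊗ₜ (h₂ ⊗ₜ h₃)) (m ⊗ₜ x) = act h₂ m ⊗ₜ (h₃ * x * HopfAlgebra.antipode k h₁) :=
  rfl

/-- A left-right anti-Yetter-Drinfeld module: a right comodule and a left module with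
`(hm)₀ ⊗ (hm)₁ = h₂ m₀ ⊗ h₃ m₁ S(h₁)`. -/
structure AYDModule (k H : Type u) [Field k] [Ring H] [HopfAlgebra k H] extends Comod k H where
  /-- the left action of `H` -/
  act : H →ₐ[k] Module.End k carrier
  ayd : ∀ (h : H) (m : carrier), coact (act h m) =
    aydMap act ((comul (R := k) (A := H)).lTensor H (comul (R := k) h)) (coact m)

namespace AYDModule

section
variable {k H : Type u} [Field k] [Ring H] [HopfAlgebra k H]

/-- Morphisms are the `H`-linear comodule morphisms. -/
@[ext] structure Hom (M N : AYDModule k H) where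
  hom : M.toComod ⟶ N.toComod
  map_act : ∀ (h : H) (m : M.carrier), Comod.lin hom (M.act h m) = N.act h (Comod.lin hom m)

instance : Category (AYDModule k H) where
  Hom := Hom
  id M := ⟨𝟙 _, fun h m => rfl⟩
  comp f g := ⟨f.hom ≫ g.hom, fun h m => by simp [f.map_act, g.map_act]⟩

/-- The underlying comodule. -/
def forget (k H : Type u) [Field k] [Ring H] [HopfAlgebra k H] : AYDModule k H ⥤ Comod k H where
  obj M := M.toComod
  map f := f.hom

/-- For a linear map `f : W → M` from a comodule this is `w ↦ w₁ f(w₀)`. -/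
noncomputable def twist (M : AYDModule k H) {W : Comod k H} (f : W.carrier →ₗ[k] M.carrier) :
    W.carrier →ₗ[k] M.carrier :=
  TensorProduct.lift M.act.toLinearMap.flip ∘ₗ f.rTensor H ∘ₗ W.coact

/-- `M` is stable if `m₁ m₀ = m` for all `m`. -/
def IsStable : ObjectProperty (AYDModule k H) := fun M =>
  ∀ m : M.carrier, M.twist (W := M.toComod) LinearMap.id m = m

end
end AYDModule

/-- The category of stable anti-Yetter-Drinfeld modules. -/
abbrev SAYDModule (k H : Type u) [Field k] [Ring H] [HopfAlgebra k H] :=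
  (AYDModule.IsStable (k := k) (H := H)).FullSubcategory

/-- The underlying comodule of a stable anti-Yetter-Drinfeld module. -/
abbrev SAYDModule.forget (k H : Type u) [Field k] [Ring H] [HopfAlgebra k H] :
    SAYDModule k H ⥤ Comod k H :=
  (AYDModule.IsStable (k := k) (H := H)).ι ⋙ AYDModule.forget k H

/-- The objects of the center whose central structure fixes the identity map. -/
abbrev StableOpCenter (C : Type*) [Category C] [MonoidalCategory C] [BiclosedCategory C] :=
  (OpCenter.FixesId (C := C)).FullSubcategory

/-- The category of representable symmetric 2-contratraces. -/
abbrev RepContratrace (k : Type*) [Field k] (C : Type*) [Category.{u} C] [MonoidalCategory C]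
    [Preadditive C] [Linear k C] :=
  (SymmContratrace.Representable (k := k) (C := C)).FullSubcategory

/-! ### Subcomodules -/

namespace Coaction

section
variable {k H : Type u} [Field k] [Ring H] [HopfAlgebra k H]
variable {W E : Type u} [AddCommGroup W] [Module k W] [AddCommGroup E] [Module k E]

/-! Both categories on the right carry the same data on a comodule `M`: maps `Hom(T ⊗ W, M) → Hom(W
⊗ T, M)` natural in `T` and `W`, here an `Exchange`. For a representable contratrace these are `ι`
itself; for an object of the center they are `τ_W` read through the two adjunctions. The theorem
rests on one classification: every exchange is `f ↦ (w ⊗ t ↦ a(w₁) f(t ⊗ w₀))` for a linear map `a :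
H → End(M)` (`Exchange.swap_eq`).

By naturality in `T`, an exchange is determined by its value on the evaluation `Homˡ(W, M) ⊗ W → M`,
that is, by a linear map `Homˡ(W, M) → Hom(W, M)` natural in `W`. Comodules are locally finite, so
finite-dimensional `W` suffice; there every linear map is rational, and `Hom(W, M) = W* ⊗ M`.
Functionals on `W` are the maps `ε ∘ p` for comodule morphisms `p : W → H`, so only the test maps `w
↦ ε(p(w)) m` matter. By naturality the value at such a map and `w` depends only on `p(w) ∈ H` and
`m` (`Exchange.coeff_eq`); it is `a(p(w)) m`.

The axioms then match. The hexagon makes `a` multiplicative (`Exchange.act_mul`); together with the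
symmetry at the identity of `M` it gives stability and then `a(1) = 1` (`Exchange.stable`,
`Exchange.act_one`). That exchanged maps are comodule morphisms is the anti-Yetter–Drinfeld
condition (`Exchange.coact_algAct`): the `S(w₁)` in the coaction of `Homˡ` is the `S(h¹)` of that
condition.

Conversely, the formula defines an exchange on a stable module; it is hexagonal because `M` is an
`H`-module and involutive by stability (`AYDModule.isHexagonal_exchange`, `AYDModule.swap_swap`). On
morphisms, compatibility with the exchanges is `H`-linearity, again by the test maps
(`AYDModule.map_act_of_twist`). Hence both functors are fully faithful and essentially surjective,
without changing the underlying comodule. -/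

lemma contract_rTensor {F Q : Type u} [AddCommGroup F] [Module k F] [AddCommGroup Q] [Module k Q]
    (c : Q →ₗ[k] k) (f : E →ₗ[k] F) (z : E ⊗[k] Q) :
    contract c (f.rTensor Q z) = f (contract c z) := by
  induction z with
  | zero => simp
  | add x y hx hy => simp only [map_add, hx, hy]
  | tmul e q => simp

/-- The contractions of a coaction are closed under contraction: for functionals `c`, `d` on `H`,
`d((c(w₁) w₀)₁) (c(w₁) w₀)₀ = (d ⊗ c)(Δ(w₁)) w₀`. -/
lemma contract_contract (ρ : W →ₗ[k] W ⊗[k] H)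
    (hρ : ∀ m, TensorProduct.assoc k W H H (ρ.rTensor H (ρ m)) =
      (comul (R := k) (A := H)).lTensor W (ρ m)) (c d : H →ₗ[k] k) (w : W) :
    contract d (ρ (contract c (ρ w))) =
      contract (LinearMap.mul' k k ∘ₗ TensorProduct.map d c ∘ₗ comul) (ρ w) := by
  have h1 : ∀ z : W ⊗[k] H, contract d (ρ (contract c z)) =
      contract (LinearMap.mul' k k ∘ₗ TensorProduct.map d c)
        (TensorProduct.assoc k W H H (ρ.rTensor H z)) := by
    intro z
    induction z with
    | zero => simp
    | add x y hx hy => simp only [map_add, hx, hy]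
    | tmul w x =>
      simp only [contract_tmul, map_smul, LinearMap.rTensor_tmul]
      generalize ρ w = s
      induction s with
      | zero => simp
      | add x y hx hy => simp only [map_add, smul_add, TensorProduct.add_tmul, hx, hy]
      | tmul v y => simp [smul_smul, mul_comm]
  rw [h1, hρ]
  generalize ρ w = s
  induction s with
  | zero => simp
  | add x y hx hy => simp only [map_add, hx, hy]
  | tmul v y => simp

end
end Coaction

namespace Comod

section
variable {k H : Type u} [Field k] [Ring H] [HopfAlgebra k H]

/-- The comodule `H` with the coaction `Δ`. -/
noncomputable abbrev regular (k H : Type u) [Field k] [Ring H] [HopfAlgebra k H] : Comod k H where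
  carrier := H
  coact := comul
  coassoc := Coalgebra.coassoc_apply
  counit_coact m := by rw [Coalgebra.lTensor_counit_comul]; simp

/-- A subspace `N` with `ρ(N) ⊆ N ⊗ H`. -/
def IsSub (X : Comod k H) (N : Submodule k X.carrier) : Prop :=
  ∀ n ∈ N, ∀ c : H →ₗ[k] k, Coaction.contract c (X.coact n) ∈ N

lemma IsSub.sup {X : Comod k H} {N N' : Submodule k X.carrier} (h : X.IsSub N) (h' : X.IsSub N') :
    X.IsSub (N ⊔ N') := by
  intro n hn c
  obtain ⟨a, ha, b, hb, rfl⟩ := Submodule.mem_sup.1 hn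
  rw [map_add, map_add]
  exact Submodule.add_mem_sup (h a ha c) (h' b hb c)

lemma isSub_range {X Y : Comod k H} (f : X ⟶ Y) : Y.IsSub (LinearMap.range (lin f)) := by
  rintro _ ⟨x, rfl⟩ c
  rw [coact_lin, Coaction.contract_rTensor]
  exact ⟨_, rfl⟩

/-- Modules over a field are flat. Identities in `N ⊗ Q` can therefore be checked in the ambient
tensor product, which is how the comodule axioms pass to subcomodules. -/
lemma rTensor_subtype_injective {E : Type u} [AddCommGroup E] [Module k E] (N : Submodule k E)
    (Q : Type u) [AddCommGroup Q] [Module k Q] : Function.Injective (N.subtype.rTensor Q) :=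
  Module.Flat.rTensor_preserves_injective_linearMap _ (Submodule.injective_subtype _)

/-- The restriction of the coaction to a subcomodule. -/
noncomputable def subCoact (X : Comod k H) (N : Submodule k X.carrier) (hN : X.IsSub N) :
    N →ₗ[k] N ⊗[k] H :=
  (LinearEquiv.ofInjective (N.subtype.rTensor H) (rTensor_subtype_injective N H)).symm.toLinearMap ∘ₗ
    (X.coact ∘ₗ N.subtype).codRestrict (LinearMap.range (N.subtype.rTensor H))
      fun n => Coaction.mem_range_of_contract N _ (hN n.1 n.2)

lemma rTensor_subCoact (X : Comod k H) (N : Submodule k X.carrier) (hN : X.IsSub N) (n : N) :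
    N.subtype.rTensor H (X.subCoact N hN n) = X.coact n :=
  congrArg Subtype.val ((LinearEquiv.ofInjective (N.subtype.rTensor H)
    (rTensor_subtype_injective N H)).apply_symm_apply _)

/-- A subcomodule as a comodule. -/
noncomputable def sub (X : Comod k H) (N : Submodule k X.carrier) (hN : X.IsSub N) :
    Comod k H where
  carrier := N
  coact := X.subCoact N hN
  coassoc n := by
    apply rTensor_subtype_injective N (H ⊗[k] H)
    have h1 : ∀ t : N ⊗[k] H, N.subtype.rTensor (H ⊗[k] H)
        (TensorProduct.assoc k N H H ((X.subCoact N hN).rTensor H t)) =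
        TensorProduct.assoc k X.carrier H H (X.coact.rTensor H (N.subtype.rTensor H t)) := by
      intro t
      induction t with
      | zero => simp
      | add x y hx hy => simp only [map_add, hx, hy]
      | tmul n x =>
        simp only [LinearMap.rTensor_tmul, Submodule.subtype_apply, ← rTensor_subCoact X N hN]
        generalize X.subCoact N hN n = s
        induction s with
        | zero => simp
        | add x y hx hy => simp only [map_add, TensorProduct.add_tmul, hx, hy]
        | tmul n y => simp
    have h2 : ∀ t : N ⊗[k] H, N.subtype.rTensor (H ⊗[k] H)
        ((comul (R := k) (A := H)).lTensor N t) =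
        (comul (R := k) (A := H)).lTensor X.carrier (N.subtype.rTensor H t) := by
      intro t
      induction t with
      | zero => simp
      | add x y hx hy => simp only [map_add, hx, hy]
      | tmul n x => simp
    rw [h1, h2, rTensor_subCoact, X.coassoc]
  counit_coact n := by
    apply Subtype.ext
    refine (Coaction.contract_rTensor counit N.subtype (X.subCoact N hN n)).symm.trans ?_
    rw [rTensor_subCoact]
    exact X.counit_coact n

/-- The inclusion of a subcomodule. -/
noncomputable def subι (X : Comod k H) (N : Submodule k X.carrier) (hN : X.IsSub N) :
    X.sub N hN ⟶ X :=
  mkHom (M := X.sub N hN) N.subtype fun n => (rTensor_subCoact X N hN n).symm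

/-- A comodule morphism with image in a subcomodule. -/
noncomputable def subLift {X Y : Comod k H} (N : Submodule k X.carrier) (hN : X.IsSub N)
    (f : Y ⟶ X) (hf : ∀ y, lin f y ∈ N) : Y ⟶ X.sub N hN :=
  mkHom (N := X.sub N hN) ((lin f).codRestrict N hf) fun y => by
    apply rTensor_subtype_injective N H
    refine (rTensor_subCoact X N hN _).trans ((coact_lin f y).trans ?_)
    exact LinearMap.rTensor_comp_apply H N.subtype ((lin f).codRestrict N hf) (Y.coact y)

lemma subLift_subι {X Y : Comod k H} (N : Submodule k X.carrier) (hN : X.IsSub N)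
    (f : Y ⟶ X) (hf : ∀ y, lin f y ∈ N) : subLift N hN f hf ≫ subι X N hN = f :=
  rfl

/-- The subcomodule generated by an element. -/
noncomputable def cyclic (X : Comod k H) (x : X.carrier) : Submodule k X.carrier :=
  Submodule.span k (Set.range fun c : H →ₗ[k] k => Coaction.contract c (X.coact x))

/-- By coassociativity, contracting a contraction of `ρ(x)` is again a contraction of `ρ(x)`, by the
convolution product of the two functionals. -/
lemma isSub_cyclic (X : Comod k H) (x : X.carrier) : X.IsSub (X.cyclic x) := by
  intro n hn c
  induction hn using Submodule.span_induction with
  | mem n hn =>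
    obtain ⟨d, rfl⟩ := hn
    dsimp only
    rw [Coaction.contract_contract _ X.coassoc]
    exact Submodule.subset_span ⟨_, rfl⟩
  | zero => simp
  | add x y _ _ hx hy => simpa only [map_add] using Submodule.add_mem _ hx hy
  | smul a x _ hx => simpa only [map_smul] using Submodule.smul_mem _ a hx

/-- The counit is one of the functionals, and contracting with it returns `x`. -/
lemma mem_cyclic (X : Comod k H) (x : X.carrier) : x ∈ X.cyclic x :=
  Submodule.subset_span ⟨counit, X.counit_coact x⟩

/-- Every element of a comodule lies in a finite-dimensional subcomodule. -/
instance finite_cyclic (X : Comod k H) (x : X.carrier) : Module.Finite k (X.cyclic x) := by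
  classical
  -- Writing `ρ(x)` as a finite sum of `xᵢ ⊗ hᵢ`, every contraction lies in the span of the finitely
  -- many `xᵢ`.
  obtain ⟨S, hS⟩ := TensorProduct.exists_finset (X.coact x)
  have : X.cyclic x ≤ Submodule.span k (S.image Prod.fst : Set X.carrier) := by
    refine Submodule.span_le.2 ?_
    rintro _ ⟨c, rfl⟩
    dsimp only
    rw [hS, map_sum]
    refine Submodule.sum_mem _ fun i hi => ?_
    rw [Coaction.contract_tmul]
    exact Submodule.smul_mem _ _ (Submodule.subset_span (Finset.mem_coe.2 (Finset.mem_image_of_mem _ hi)))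
  exact Submodule.finiteDimensional_of_le this

instance (X : Comod k H) (N : Submodule k X.carrier) (hN : X.IsSub N) [h : Module.Finite k N] :
    Module.Finite k (X.sub N hN).carrier := h

instance (X Y : Comod k H) [h : Module.Finite k X.carrier] [h' : Module.Finite k Y.carrier] :
    Module.Finite k (X ⊗ Y).carrier :=
  inferInstanceAs (Module.Finite k (X.carrier ⊗[k] Y.carrier))

end
end Comod

/-! ### Natural exchanges of tensor factors -/

namespace Comod

section
variable {k H : Type u} [Field k] [Ring H] [HopfAlgebra k H]

/-- For a linear map `f : W → M` this is `w ↦ a(w₁) f(w₀)`. -/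
noncomputable def actTwist {M : Type u} [AddCommGroup M] [Module k M]
    (a : H →ₗ[k] Module.End k M) (W : Comod k H) :
    (W.carrier →ₗ[k] M) →ₗ[k] (W.carrier →ₗ[k] M) where
  toFun f := TensorProduct.lift a.flip ∘ₗ f.rTensor H ∘ₗ W.coact
  map_add' f g := by simp [LinearMap.rTensor_add, LinearMap.add_comp, LinearMap.comp_add]
  map_smul' c f := by simp [LinearMap.rTensor_smul, LinearMap.smul_comp, LinearMap.comp_smul]

section
variable {M M' : Type u} [AddCommGroup M] [Module k M] [AddCommGroup M'] [Module k M']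
  (a : H →ₗ[k] Module.End k M)

lemma actTwist_apply (W : Comod k H) (f : W.carrier →ₗ[k] M) (w : W.carrier) :
    actTwist a W f w = TensorProduct.lift a.flip (f.rTensor H (W.coact w)) := rfl

/-- A comodule morphism satisfies `φ(w)₀ ⊗ φ(w)₁ = φ(w₀) ⊗ w₁`. This is the source of naturality in
`W` for the exchange and for `τ_W`. -/
lemma actTwist_comp_lin {W W' : Comod k H} (φ : W' ⟶ W) (f : W.carrier →ₗ[k] M) :
    actTwist a W' (f ∘ₗ lin φ) = actTwist a W f ∘ₗ lin φ := by
  ext w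
  rw [LinearMap.comp_apply, actTwist_apply, actTwist_apply, coact_lin, LinearMap.rTensor_comp_apply]

/-- No coaction on the target is required, so besides `H`-linear maps of modules this also covers `θ
= ρ : M → M ⊗ H`, where the action on `M ⊗ H` is the one in the anti-Yetter–Drinfeld condition. -/
lemma actTwist_comp (a' : H →ₗ[k] Module.End k M') (θ : M →ₗ[k] M')
    (hθ : ∀ h m, θ (a h m) = a' h (θ m)) (W : Comod k H) (f : W.carrier →ₗ[k] M) :
    actTwist a' W (θ ∘ₗ f) = θ ∘ₗ actTwist a W f := by
  ext w
  rw [LinearMap.comp_apply, actTwist_apply, actTwist_apply]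
  generalize W.coact w = t
  induction t with
  | zero => simp
  | add x y hx hy => simp only [map_add, hx, hy]
  | tmul w x => simp [hθ]

/-- `w ↦ ε(p(w)) m` -/
noncomputable def counitMap {W : Comod k H} (p : W ⟶ regular k H) :
    M →ₗ[k] W.carrier →ₗ[k] M :=
  LinearMap.smulRightₗ ((counit (R := k) (A := H)) ∘ₗ lin p)

lemma counitMap_apply {W : Comod k H} (p : W ⟶ regular k H) (m : M) (w : W.carrier) :
    counitMap p m w = counit (R := k) (A := H) (lin p w) • m := rfl

/-- `a(w₁) ε(p(w₀)) m = a(p(w)) m` -/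
lemma actTwist_counitMap {W : Comod k H} (p : W ⟶ regular k H) (m : M) (w : W.carrier) :
    actTwist a W (counitMap p m) w = a (lin p w) m := by
  have h1 : ∀ t : W.carrier ⊗[k] H, TensorProduct.lift a.flip ((counitMap p m).rTensor H t) =
      a (TensorProduct.lid k H (counit.rTensor H ((lin p).rTensor H t))) m := by
    intro t
    induction t with
    | zero => simp
    | add x y hx hy => simp only [map_add, LinearMap.add_apply, hx, hy]
    | tmul w x => simp [counitMap_apply]
  have h2 := Coalgebra.rTensor_counit_comul (R := k) (A := H) (lin p w)
  -- Since `p` is a comodule morphism, `p(w₀) ⊗ w₁ = Δ(p(w))`, so the counit axiom collapses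
  -- `ε(p(w₀)) w₁` to `p(w)`.
  rw [actTwist_apply, h1, ← coact_lin p w]
  change a (TensorProduct.lid k H (counit.rTensor H (comul (R := k) (A := H) (lin p w)))) m = _
  rw [h2]
  simp

end

/-- The comodule morphism `W → H`, `w ↦ φ(w₀) w₁`, for a functional `φ`. -/
noncomputable def toRegular (W : Comod k H) (φ : W.carrier →ₗ[k] k) : W ⟶ regular k H :=
  mkHom (N := regular k H) ((TensorProduct.lid k H).toLinearMap ∘ₗ φ.rTensor H ∘ₗ W.coact)
    fun w => by
      have h1 : ∀ t : W.carrier ⊗[k] H, comul (R := k) (TensorProduct.lid k H (φ.rTensor H t)) =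
          TensorProduct.lid k (H ⊗[k] H) (φ.rTensor (H ⊗[k] H) (comul.lTensor W.carrier t)) := by
        intro t
        induction t with
        | zero => simp
        | add x y hx hy => simp only [map_add, hx, hy]
        | tmul w x => simp
      have h2 : ∀ t : W.carrier ⊗[k] H,
          ((TensorProduct.lid k H).toLinearMap ∘ₗ φ.rTensor H ∘ₗ W.coact).rTensor H t =
          TensorProduct.lid k (H ⊗[k] H) (φ.rTensor (H ⊗[k] H)
            (TensorProduct.assoc k W.carrier H H (W.coact.rTensor H t))) := by
        intro t
        induction t with
        | zero => simp
        | add x y hx hy => simp only [map_add, hx, hy]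
        | tmul w x =>
          simp only [LinearMap.rTensor_tmul, LinearMap.comp_apply, LinearEquiv.coe_coe]
          generalize W.coact w = s
          induction s with
          | zero => simp
          | add x y hx hy => simp only [map_add, TensorProduct.add_tmul, hx, hy]
          | tmul w y => simp [TensorProduct.smul_tmul']
      refine (h1 _).trans (Eq.trans ?_ (h2 _).symm)
      rw [W.coassoc]

/-- `H` is the cofree comodule on `k`: composing with `ε` recovers the functional from its comodule
morphism to `H`. -/
lemma counit_toRegular (W : Comod k H) (φ : W.carrier →ₗ[k] k) (w : W.carrier) :
    counit (R := k) (A := H) (lin (W.toRegular φ) w) = φ w := by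
  have h1 : ∀ t : W.carrier ⊗[k] H, counit (R := k) (TensorProduct.lid k H (φ.rTensor H t)) =
      φ (Coaction.contract counit t) := by
    intro t
    induction t with
    | zero => simp
    | add x y hx hy => simp only [map_add, hx, hy]
    | tmul w x => simp [mul_comm]
  exact (h1 _).trans (congrArg φ (W.counit_coact w))

/-- Consequently every map of the form `φ(-) m` is one of the test maps, and on finite-dimensional
`W` the test maps span `Hom(W, M)`. -/
lemma counitMap_toRegular {M : Type u} [AddCommGroup M] [Module k M] (W : Comod k H)
    (φ : W.carrier →ₗ[k] k) (m : M) : counitMap (W.toRegular φ) m = φ.smulRight m := by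
  ext w
  rw [counitMap_apply, counit_toRegular]
  rfl

/-- Linear maps on a finite-dimensional comodule that agree on `w ↦ ε(p(w)) m` are equal. -/
lemma hom_ext_counitMap {M E : Type u} [AddCommGroup M] [Module k M] [AddCommGroup E] [Module k E]
    (W : Comod k H) [Module.Finite k W.carrier] {F G : (W.carrier →ₗ[k] M) →ₗ[k] E}
    (h : ∀ (p : W ⟶ regular k H) (m : M), F (counitMap p m) = G (counitMap p m)) : F = G := by
  -- Finite dimension enters through `W* ⊗ M ≃ Hom(W, M)`, whose pure tensors correspond to test
  -- maps.
  have : F ∘ₗ (dualTensorHomEquiv k W.carrier M).toLinearMap =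
      G ∘ₗ (dualTensorHomEquiv k W.carrier M).toLinearMap := by
    refine TensorProduct.ext' fun φ m => ?_
    have h1 : dualTensorHomEquiv k W.carrier M (φ ⊗ₜ m) = counitMap (W.toRegular φ) m := by
      rw [counitMap_toRegular]
      ext w
      simp
    simp only [LinearMap.comp_apply, LinearEquiv.coe_coe, h1, h]
  ext f
  obtain ⟨t, rfl⟩ := (dualTensorHomEquiv k W.carrier M).surjective f
  exact LinearMap.congr_fun this t

/-- All linear maps from a finite-dimensional comodule are rational. -/
noncomputable def homLOfFinite (W M : Comod k H) [Module.Finite k W.carrier] :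
    (W.carrier →ₗ[k] M.carrier) →ₗ[k] ((homL W).obj M).carrier :=
  LinearMap.codRestrict (Coaction.ratHom (Coaction.mulS k H) W.coact M.coact) LinearMap.id
    fun f => by
      -- For finite-dimensional `W` the canonical map `Hom(W, M) ⊗ H → Hom(W, M ⊗ H)` is onto, so
      -- rationality is automatic.
      obtain ⟨z, hz⟩ := (rTensorHomEquivHomRTensor k W.carrier M.carrier H).surjective
        (Coaction.homCoact (Coaction.mulS k H) W.coact M.coact f)
      exact ⟨z, by rw [LinearMap.id_apply, ← hz]; exact (rTensorHomEquivHomRTensor_apply ..).symm⟩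

lemma homLVal_homLOfFinite (W M : Comod k H) [Module.Finite k W.carrier]
    (f : W.carrier →ₗ[k] M.carrier) : homLVal (homLOfFinite W M f) = f := rfl

end
end Comod

/-- A natural family of maps `Hom(T ⊗ W, M) → Hom(W ⊗ T, M)`. -/
structure Exchange {C : Type*} [Category C] [MonoidalCategory C] (M : C) where
  swap : ∀ T W : C, (T ⊗ W ⟶ M) → (W ⊗ T ⟶ M)
  natural : ∀ {T T' W W' : C} (a : T' ⟶ T) (b : W' ⟶ W) (f : T ⊗ W ⟶ M),
    swap T' W' ((a ⊗ₘ b) ≫ f) = (b ⊗ₘ a) ≫ swap T W f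

namespace Comod

section
variable {k H : Type u} [Field k] [Ring H] [HopfAlgebra k H]

/-- evaluation `Homˡ(W, M) ⊗ W ⟶ M` -/
noncomputable def ev (W M : Comod k H) : (homL W).obj M ⊗ W ⟶ M := (homLEquiv _ W M).symm (𝟙 _)

lemma homLVal_injective {W M : Comod k H} {f g : ((homL W).obj M).carrier}
    (h : homLVal f = homLVal g) : f = g :=
  Subtype.ext h

lemma tensor_hom_ext {T W M : Comod k H} {f g : T ⊗ W ⟶ M}
    (h : ∀ t w, lin f (t ⊗ₜ[k] w) = lin g (t ⊗ₜ[k] w)) : f = g :=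
  hom_ext (TensorProduct.ext' h)

instance (h : H) : Module.Finite k ((regular k H).cyclic h) :=
  finite_cyclic (regular k H) h

end
end Comod

/-! ### The linear map `H → End(M)` behind an exchange. -/

namespace Exchange

open Comod

section
variable {k H : Type u} [Field k] [Ring H] [HopfAlgebra k H] {M : Comod k H} (s : Exchange M)

/-- The map `Homˡ(W, M) → Hom(W, M)` induced by an exchange. -/
noncomputable def eval (W : Comod k H) :
    ((homL W).obj M).carrier →ₗ[k] (W.carrier →ₗ[k] M.carrier) :=
  LinearMap.flip (TensorProduct.curry (lin (s.swap _ W (ev W M))))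

/-- Yoneda: `f` is its transpose tensored with `W`, followed by evaluation, so naturality in `T`
reduces the exchange of `f` to that of the evaluation. Linearity of the exchange in `f` is not
needed; `eval` is linear because the exchanged evaluation is a linear map. -/
lemma swap_tmul {T W : Comod k H} (f : T ⊗ W ⟶ M) (t : T.carrier) (w : W.carrier) :
    lin (s.swap T W f) (w ⊗ₜ[k] t) = s.eval W (lin (homLEquiv T W M f) t) w := by
  have h : (homLEquiv T W M f ⊗ₘ 𝟙 W) ≫ ev W M = f := tensor_hom_ext fun _ _ => rfl
  conv_lhs => rw [← h, s.natural]
  rfl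

/-- Naturality in the second variable. Restriction along `φ` is the transpose of `id ⊗ φ` followed
by evaluation, so `g'` is the value of that transpose at `g`. -/
lemma eval_comp {W W' : Comod k H} (φ : W' ⟶ W) (g : ((homL W).obj M).carrier)
    (g' : ((homL W').obj M).carrier) (h : homLVal g' = homLVal g ∘ₗ lin φ) :
    s.eval W' g' = s.eval W g ∘ₗ lin φ := by
  ext w
  have h1 : g' = lin (homLEquiv _ W' M ((𝟙 _ ⊗ₘ φ) ≫ ev W M)) g := homLVal_injective h
  rw [h1, ← swap_tmul, s.natural]
  rfl

/-- The value of an exchange on the map `w ↦ ε(p(w)) m`. -/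
noncomputable def coeff {W : Comod k H} [Module.Finite k W.carrier] (p : W ⟶ regular k H)
    (w : W.carrier) : M.carrier →ₗ[k] M.carrier :=
  LinearMap.flip (s.eval W ∘ₗ homLOfFinite W M ∘ₗ counitMap p) w

lemma coeff_apply {W : Comod k H} [Module.Finite k W.carrier] (p : W ⟶ regular k H)
    (w : W.carrier) (m : M.carrier) :
    s.coeff p w m = s.eval W (homLOfFinite W M (counitMap p m)) w := rfl

lemma coeff_comp {W W' : Comod k H} [Module.Finite k W.carrier] [Module.Finite k W'.carrier]
    (φ : W' ⟶ W) (p : W ⟶ regular k H) (w : W'.carrier) :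
    s.coeff (φ ≫ p) w = s.coeff p (lin φ w) := by
  ext m
  rw [coeff_apply, coeff_apply, s.eval_comp φ (homLOfFinite W M (counitMap p m))]
  · rfl
  · rfl

/-- The two morphisms need not be related, but both factor through the finite-dimensional
subcomodule `im p + im p'` of `H`, in which `w` and `w'` have the same image. Naturality along the
two factorizations identifies both coefficients with the coefficient of that image. -/
lemma coeff_eq {W W' : Comod k H} [Module.Finite k W.carrier] [Module.Finite k W'.carrier]
    (p : W ⟶ regular k H) (p' : W' ⟶ regular k H) (w : W.carrier) (w' : W'.carrier)
    (h : lin p w = lin p' w') : s.coeff p w = s.coeff p' w' := by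
  have h0 := (isSub_range p).sup (isSub_range p')
  have h1 := s.coeff_comp (subLift _ h0 p fun w => Submodule.mem_sup_left ⟨w, rfl⟩)
    (subι _ _ h0) w
  have h2 := s.coeff_comp (subLift _ h0 p' fun w => Submodule.mem_sup_right ⟨w, rfl⟩)
    (subι _ _ h0) w'
  rw [subLift_subι] at h1 h2
  rw [h1, h2]
  congr 1
  exact Subtype.ext h

/-- The action of an element of `H` induced by an exchange. -/
noncomputable def actElem (h : H) : M.carrier →ₗ[k] M.carrier :=
  s.coeff (subι _ _ ((regular k H).isSub_cyclic h))
    (⟨h, (regular k H).mem_cyclic h⟩ : (regular k H).cyclic h)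

/-- Any finite-dimensional comodule over `H` with a preimage of `h` may serve to compute the action
of `h`; the cyclic subcomodule in the definition is only one choice. -/
lemma actElem_eq {W : Comod k H} [Module.Finite k W.carrier] (p : W ⟶ regular k H)
    (w : W.carrier) {h : H} (hw : lin p w = h) : s.actElem h = s.coeff p w :=
  s.coeff_eq _ _ _ _ hw.symm

/-- The map `H → End(M)` induced by an exchange. -/
noncomputable def act : H →ₗ[k] Module.End k M.carrier where
  toFun := s.actElem
  map_add' h h' := by
    -- One subcomodule containing `h`, `h'` and `h + h'`; for a fixed morphism to `H` the
    -- coefficient is linear in the vector.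
    let hN := ((regular k H).isSub_cyclic h).sup ((regular k H).isSub_cyclic h')
    let w : (sub _ _ hN).carrier := ⟨h, Submodule.mem_sup_left ((regular k H).mem_cyclic h)⟩
    let w' : (sub _ _ hN).carrier := ⟨h', Submodule.mem_sup_right ((regular k H).mem_cyclic h')⟩
    rw [s.actElem_eq (subι _ _ hN) w (h := h) rfl, s.actElem_eq (subι _ _ hN) w' (h := h') rfl,
      s.actElem_eq (subι _ _ hN) (w + w') (h := h + h') rfl]
    exact map_add (LinearMap.flip (s.eval _ ∘ₗ homLOfFinite _ M ∘ₗ counitMap (subι _ _ hN))) w w'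
  map_smul' c h := by
    let hN := (regular k H).isSub_cyclic h
    let w : (sub _ _ hN).carrier := ⟨h, (regular k H).mem_cyclic h⟩
    rw [s.actElem_eq (subι _ _ hN) w (h := h) rfl, s.actElem_eq (subι _ _ hN) (c • w) (h := c • h) rfl]
    exact map_smul (LinearMap.flip (s.eval _ ∘ₗ homLOfFinite _ M ∘ₗ counitMap (subι _ _ hN))) c w

lemma coeff_eq_act {W : Comod k H} [Module.Finite k W.carrier] (p : W ⟶ regular k H)
    (w : W.carrier) : s.coeff p w = s.act (lin p w) :=
  (s.actElem_eq p w rfl).symm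

/-- Both sides are linear in `f`, and on the test map `ε(p(-)) m` both give `a(p(w)) m`. -/
lemma eval_homLOfFinite {W : Comod k H} [Module.Finite k W.carrier]
    (f : W.carrier →ₗ[k] M.carrier) : s.eval W (homLOfFinite W M f) = actTwist s.act W f := by
  refine LinearMap.congr_fun (f := s.eval W ∘ₗ homLOfFinite W M) (hom_ext_counitMap W ?_) f
  intro p m
  ext w
  rw [actTwist_counitMap, ← coeff_eq_act]
  rfl

/-- Local finiteness: the value at `w` can be computed after restriction to the finite-dimensional
subcomodule generated by `w`. Both sides are compatible with this restriction. -/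
lemma eval_eq {W : Comod k H} (f : ((homL W).obj M).carrier) :
    s.eval W f = actTwist s.act W (homLVal f) := by
  ext w
  have hN := W.isSub_cyclic w
  have h := s.eval_comp (subι _ _ hN) f (homLOfFinite _ M (homLVal f ∘ₗ lin (subι _ _ hN))) rfl
  rw [eval_homLOfFinite, actTwist_comp_lin] at h
  exact (LinearMap.congr_fun h (⟨w, W.mem_cyclic w⟩ : W.cyclic w)).symm

/-- Every exchange has the form `w ⊗ t ↦ a(w₁) f(t ⊗ w₀)`. -/
lemma swap_eq {T W : Comod k H} (f : T ⊗ W ⟶ M) (t : T.carrier) (w : W.carrier) :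
    lin (s.swap T W f) (w ⊗ₜ[k] t) =
      actTwist s.act W (lin f ∘ₗ TensorProduct.mk k T.carrier W.carrier t) w := by
  rw [swap_tmul, eval_eq]
  rfl

end
end Exchange

/-! ### Twisted maps and coactions. -/

namespace Comod

section
variable {k H : Type u} [Field k] [Ring H] [HopfAlgebra k H]

/-- The bilinear form of `actTwist`: for `f : T ⊗ W → M` this is `w ⊗ t ↦ a(w₁) f(t ⊗ w₀)`. -/
noncomputable def swapLin {M : Type u} [AddCommGroup M] [Module k M]
    (a : H →ₗ[k] Module.End k M) (T W : Comod k H) (f : T.carrier ⊗[k] W.carrier →ₗ[k] M) :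
    W.carrier ⊗[k] T.carrier →ₗ[k] M :=
  TensorProduct.lift (actTwist a W ∘ₗ TensorProduct.curry f).flip

/-- `x ↦ (m ⊗ h ↦ a(x₁) m ⊗ x₂ h)` -/
noncomputable def diagAct {M : Type u} [AddCommGroup M] [Module k M]
    (a : H →ₗ[k] Module.End k M) : H →ₗ[k] Module.End k (M ⊗[k] H) :=
  TensorProduct.homTensorHomMap (RingHom.id k) M H M H ∘ₗ
    TensorProduct.map a (LinearMap.mul k H) ∘ₗ comul

/-- `x ↦ (m ⊗ h ↦ x₂ m ⊗ x₃ h S(x₁))` -/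
noncomputable def aydAct {M : Type u} [AddCommGroup M] [Module k M]
    (a : H →ₐ[k] Module.End k M) : H →ₗ[k] Module.End k (M ⊗[k] H) :=
  aydMap a ∘ₗ (comul (R := k) (A := H)).lTensor H ∘ₗ comul

/-- By coassociativity both sides are `a(w₁) g(w₀) ⊗ w₂ y`. -/
lemma actTwist_diagAct_tmul {M : Type u} [AddCommGroup M] [Module k M]
    (a : H →ₗ[k] Module.End k M) (W : Comod k H) (g : W.carrier →ₗ[k] M) (y : H) (w : W.carrier) :
    actTwist (diagAct a) W ((TensorProduct.mk k M H).flip y ∘ₗ g) w =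
      TensorProduct.map (actTwist a W g) (LinearMap.mulRight k y) (W.coact w) := by
  have h1 : ∀ t : W.carrier ⊗[k] H,
      TensorProduct.map (actTwist a W g) (LinearMap.mulRight k y) t =
      TensorProduct.map (TensorProduct.lift a.flip ∘ₗ g.rTensor H) (LinearMap.mulRight k y)
        (W.coact.rTensor H t) := by
    intro t
    induction t with
    | zero => simp
    | add x y hx hy => simp only [map_add, hx, hy]
    | tmul w x => rfl
  rw [h1, ← (TensorProduct.assoc k W.carrier H H).symm_apply_apply
    (W.coact.rTensor H (W.coact w)), W.coassoc, actTwist_apply]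
  generalize W.coact w = t
  induction t with
  | zero => simp
  | add x y hx hy => simp only [map_add, hx, hy]
  | tmul w x =>
    simp only [LinearMap.rTensor_tmul, TensorProduct.lift.tmul, LinearMap.flip_apply, diagAct,
      LinearMap.comp_apply, LinearMap.lTensor_tmul, TensorProduct.mk_apply]
    generalize (comul (R := k) x : H ⊗[k] H) = s
    induction s with
    | zero => simp
    | add x y hx hy => simp only [map_add, TensorProduct.tmul_add, LinearMap.add_apply, hx, hy]
    | tmul c d => simp

/-- The origin of the anti-Yetter–Drinfeld condition. The coaction of `Homˡ` contributes `S(w₁)` on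
the right, and the diagonal action then contributes `w₂` on `M` and `w₃` on the left of `H`. Both
sides are `w₂ g(w₀)₀ ⊗ w₃ g(w₀)₁ S(w₁)`. -/
lemma actTwist_diagAct_homCoact {M : Type u} [AddCommGroup M] [Module k M]
    (a : H →ₐ[k] Module.End k M) (ρ : M →ₗ[k] M ⊗[k] H) (W : Comod k H)
    (g : W.carrier →ₗ[k] M) (w : W.carrier) :
    actTwist (diagAct a.toLinearMap) W (Coaction.homCoact (Coaction.mulS k H) W.coact ρ g) w =
      actTwist (aydAct a) W (ρ ∘ₗ g) w := by
  have h1 : (Coaction.homCoact (Coaction.mulS k H) W.coact ρ g).rTensor H (W.coact w) =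
      ((Coaction.mulS k H).lTensor M ∘ₗ (TensorProduct.assoc k M H H).toLinearMap ∘ₗ
        (ρ ∘ₗ g).rTensor H).rTensor H (W.coact.rTensor H (W.coact w)) := by
    rw [← LinearMap.rTensor_comp_apply]
    rfl
  rw [actTwist_apply, actTwist_apply, h1, ← (TensorProduct.assoc k W.carrier H H).symm_apply_apply
    (W.coact.rTensor H (W.coact w)), W.coassoc]
  generalize W.coact w = t
  induction t with
  | zero => simp
  | add x y hx hy => simp only [map_add, hx, hy]
  | tmul w x =>
    simp only [LinearMap.rTensor_tmul, TensorProduct.lift.tmul, LinearMap.flip_apply, aydAct,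
      LinearMap.comp_apply, LinearMap.lTensor_tmul]
    generalize (comul (R := k) x : H ⊗[k] H) = s
    induction s with
    | zero => simp
    | add x y hx hy => simp only [map_add, TensorProduct.tmul_add, LinearMap.add_apply, hx, hy]
    | tmul c d =>
      simp only [LinearMap.rTensor_tmul, TensorProduct.lift.tmul, LinearMap.flip_apply, diagAct,
        LinearMap.comp_apply, LinearMap.lTensor_tmul, TensorProduct.assoc_symm_tmul,
        LinearEquiv.coe_coe]
      generalize (comul (R := k) d : H ⊗[k] H) = s
      generalize ρ (g w) = z
      induction s with
      | zero => simp
      | add x y hx hy => simp only [map_add, TensorProduct.tmul_add, LinearMap.add_apply, hx, hy]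
      | tmul d e =>
        induction z with
        | zero => simp
        | add x y hx hy => simp only [map_add, TensorProduct.add_tmul, hx, hy]
        | tmul m y => simp [Coaction.mulS, aydMap_tmul, mul_assoc]

/-- For a comodule morphism `f : T ⊗ W → M` and `g(w ⊗ t) = w₁ f(t ⊗ w₀)` this computes
`g(w₀ ⊗ t₀) ⊗ w₁ t₁`. -/
lemma rTensor_swapLin {M T W : Comod k H} (a : H →ₐ[k] Module.End k M.carrier) (f : T ⊗ W ⟶ M)
    (w : W.carrier) (t : T.carrier) :
    (swapLin a.toLinearMap T W (lin f)).rTensor H (Coaction.tensor W.coact T.coact (w ⊗ₜ t)) =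
      actTwist (aydAct a) W
        (M.coact ∘ₗ lin f ∘ₗ TensorProduct.mk k T.carrier W.carrier t) w := by
  -- As `f` is a comodule morphism, its transpose is one too: `ρˡ(f(t ⊗ -)) = f(t₀ ⊗ -) ⊗ t₁`. This
  -- turns the left side into a diagonal twist of `ρˡ(f(t ⊗ -))`.
  have h1 : Coaction.homCoact (Coaction.mulS k H) W.coact M.coact
      (TensorProduct.curry (lin f) t) = _ :=
    (Coaction.lift_comm_iff (ρT := T.coact) W.coassoc W.counit_coact
      (TensorProduct.curry (lin f))).1 (by rw [lift_curry]; exact coact_lin f) t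
  have h2 := actTwist_diagAct_homCoact a M.coact W (TensorProduct.curry (lin f) t) w
  refine Eq.trans ?_ h2
  rw [h1, Coaction.tensor_tmul]
  generalize T.coact t = z
  induction z with
  | zero => simp
  | add x y hx hy => simp only [map_add, TensorProduct.tmul_add, LinearMap.add_apply, hx, hy]
  | tmul t y =>
    have h3 := actTwist_diagAct_tmul a.toLinearMap W (TensorProduct.curry (lin f) t) y w
    refine Eq.trans ?_ h3.symm
    generalize W.coact w = r
    induction r with
    | zero => simp
    | add x y hx hy => simp only [map_add, TensorProduct.add_tmul, hx, hy]
    | tmul w x => simp [swapLin]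

/-- The multiplication of `H` as a comodule morphism. -/
noncomputable def mulHom (k H : Type u) [Field k] [Ring H] [HopfAlgebra k H] :
    regular k H ⊗ regular k H ⟶ regular k H :=
  mkHom (M := tensor (regular k H) (regular k H)) (LinearMap.mul' k H) fun (t : H ⊗[k] H) => by
    induction t with
    | zero => simp
    | add x y hx hy => simp only [map_add, hx, hy]
    | tmul g h =>
      rw [LinearMap.mul'_apply, Bialgebra.comul_mul, Coaction.tensor_tmul]
      generalize (comul (R := k) g : H ⊗[k] H) = s
      generalize (comul (R := k) h : H ⊗[k] H) = r
      induction s with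
      | zero => simp
      | add x y hx hy => simp only [map_add, TensorProduct.add_tmul, add_mul, hx, hy]
      | tmul a b =>
        induction r with
        | zero => simp
        | add x y hx hy => simp only [map_add, TensorProduct.tmul_add, mul_add, hx, hy]
        | tmul c d => simp

end
end Comod

/-! ### From hexagonal, symmetric exchanges to stable anti-Yetter–Drinfeld modules. -/

namespace Exchange

open Comod

section
variable {k H : Type u} [Field k] [Ring H] [HopfAlgebra k H] {M : Comod k H} (s : Exchange M)

/-- The compatibility of an exchange with tensor products. -/
def IsHexagonal {C : Type*} [Category C] [MonoidalCategory C] {M : C} (s : Exchange M) : Prop :=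
  ∀ (U V W : C) (f : U ⊗ (V ⊗ W) ⟶ M), s.swap U (V ⊗ W) f =
    (α_ V W U).hom ≫ s.swap (W ⊗ U) V ((α_ W U V).hom ≫ s.swap (U ⊗ V) W ((α_ U V W).hom ≫ f))

/-- The symmetry of an exchange at the identity of `M`. -/
def IsSymmAtId {C : Type*} [Category C] [MonoidalCategory C] {M : C} (s : Exchange M) : Prop :=
  s.swap (𝟙_ C) M (s.swap M (𝟙_ C) (ρ_ M).hom) = (ρ_ M).hom

/-- The hexagon is evaluated on finite-dimensional subcomodules `V ∋ g` and `W ∋ h` of `H` and the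
test map `v ⊗ w ↦ ε(vw) m`. Multiplication is a comodule morphism `V ⊗ W → H`, so exchanging `V ⊗ W`
at once gives `a(gh) m`. Since `ε(vw) = ε(v) ε(w)`, exchanging `W` and then `V` gives `a(g) a(h) m`.
-/
lemma act_mul (hs : s.IsHexagonal) (g h : H) (m : M.carrier) :
    s.act (g * h) m = s.act g (s.act h m) := by
  let V := sub _ _ ((regular k H).isSub_cyclic g)
  let W := sub _ _ ((regular k H).isSub_cyclic h)
  let p : V ⟶ regular k H := subι _ _ ((regular k H).isSub_cyclic g)
  let q : W ⟶ regular k H := subι _ _ ((regular k H).isSub_cyclic h)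
  let v : V.carrier := (⟨g, (regular k H).mem_cyclic g⟩ : (regular k H).cyclic g)
  let w : W.carrier := (⟨h, (regular k H).mem_cyclic h⟩ : (regular k H).cyclic h)
  let U := (homL (V ⊗ W)).obj M
  let u : U.carrier := homLOfFinite (V ⊗ W) M (counitMap ((p ⊗ₘ q) ≫ mulHom k H) m)
  have h0 := congrArg (fun f => lin f ((v ⊗ₜ[k] w) ⊗ₜ[k] u)) (hs U V W (ev (V ⊗ W) M))
  have hl := s.swap_eq (ev (V ⊗ W) M) u (v ⊗ₜ[k] w)
  change _ = actTwist s.act (V ⊗ W) (counitMap ((p ⊗ₘ q) ≫ mulHom k H) m) (v ⊗ₜ[k] w) at hl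
  rw [actTwist_counitMap] at hl
  -- After `W` has been exchanged, what remains is a test map on `V` with vector `a(h) m`.
  have hZ : ∀ v' : V.carrier, lin (s.swap (U ⊗ V) W ((α_ U V W).hom ≫ ev (V ⊗ W) M))
      (w ⊗ₜ[k] (u ⊗ₜ[k] v')) = counitMap p (s.act h m) v' := by
    intro v'
    refine (s.swap_eq _ _ _).trans ?_
    have : lin ((α_ U V W).hom ≫ ev (V ⊗ W) M) ∘ₗ
        TensorProduct.mk k (U ⊗ V).carrier W.carrier (u ⊗ₜ[k] v') =
        counitMap q (counit (R := k) (A := H) (lin p v') • m) := by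
      ext w'
      change counit (R := k) (A := H) (lin p v' * lin q w') • m = _
      rw [Bialgebra.counit_mul, counitMap_apply, smul_smul, mul_comm]
    rw [this, actTwist_counitMap, map_smul]
    rfl
  have hr := s.swap_eq ((α_ W U V).hom ≫ s.swap (U ⊗ V) W ((α_ U V W).hom ≫ ev (V ⊗ W) M))
    (w ⊗ₜ[k] u) v
  have hY : lin ((α_ W U V).hom ≫ s.swap (U ⊗ V) W ((α_ U V W).hom ≫ ev (V ⊗ W) M)) ∘ₗ
      TensorProduct.mk k (W ⊗ U).carrier V.carrier (w ⊗ₜ[k] u) = counitMap p (s.act h m) :=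
    LinearMap.ext hZ
  rw [hY, actTwist_counitMap] at hr
  exact hl.symm.trans (h0.trans hr)

/-- In the trivial comodule `w₁ = 1`. The operator `a 1` is kept, since `a` is not assumed unital.
-/
lemma actTwist_unit {M : Type u} [AddCommGroup M] [Module k M]
    (a : H →ₗ[k] Module.End k M) (f : k →ₗ[k] M) :
    actTwist a (Comod.unit k H) f = a 1 ∘ₗ f := by
  refine LinearMap.ext_ring ?_
  change TensorProduct.lift a.flip (f.rTensor H ((1 : k) ⊗ₜ[k] (1 : H))) = _
  simp

/-- `a(m₁) a(1) m₀ = m` -/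
lemma actTwist_act_one (hs : s.IsSymmAtId) (m : M.carrier) :
    actTwist s.act M (s.act 1) m = m := by
  have h := congrArg (fun f => lin f (m ⊗ₜ[k] (1 : k))) hs
  -- Moving `k` past `M` applies `a(1)`; moving `M` back past `k` applies the twist `a(m₁)`.
  have h1 : lin (s.swap M (𝟙_ (Comod k H)) (ρ_ M).hom) ∘ₗ
      TensorProduct.mk k (𝟙_ (Comod k H)).carrier M.carrier (1 : k) = s.act 1 := by
    ext m'
    refine (s.swap_eq (T := M) (W := Comod.unit k H) (ρ_ M).hom m' (1 : k)).trans ?_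
    rw [actTwist_unit]
    exact congrArg (s.act 1) (one_smul k m')
  rw [← h1]
  exact (s.swap_eq _ _ _).symm.trans (h.trans (one_smul k m))

/-- Multiplicativity absorbs the surplus unit: `a(m₁) a(1) = a(m₁)`. -/
lemma stable (hs : s.IsHexagonal) (hs' : s.IsSymmAtId) (m : M.carrier) :
    actTwist s.act M LinearMap.id m = m := by
  refine Eq.trans ?_ (s.actTwist_act_one hs' m)
  rw [actTwist_apply, actTwist_apply]
  generalize M.coact m = t
  induction t with
  | zero => simp
  | add x y hx hy => simp only [map_add, hx, hy]
  | tmul m x => simp [← s.act_mul hs]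

/-- By stability each `m` equals `a(m₁) m₀`, and `a(1)` fixes everything of the form `a(x) n`
because `a` is multiplicative. Unitality thus follows from stability instead of being required of
the exchange. -/
lemma act_one (hs : s.IsHexagonal) (hs' : s.IsSymmAtId) (m : M.carrier) : s.act 1 m = m := by
  have h : ∀ t : M.carrier ⊗[k] H, s.act 1 (TensorProduct.lift s.act.flip t) =
      TensorProduct.lift s.act.flip t := by
    intro t
    induction t with
    | zero => simp
    | add x y hx hy => simp only [map_add, hx, hy]
    | tmul m x => simp [← s.act_mul hs]
  rw [← s.stable hs hs' m]
  exact h _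

/-- The algebra map `H → End(M)` induced by a symmetric exchange. -/
noncomputable def algAct (hs : s.IsHexagonal) (hs' : s.IsSymmAtId) :
    H →ₐ[k] Module.End k M.carrier :=
  AlgHom.ofLinearMap s.act (LinearMap.ext (s.act_one hs hs'))
    fun g h => LinearMap.ext (s.act_mul hs g h)

/-- The exchanged evaluation is a comodule morphism. At `h ⊗ u`, with `u` the test map of `m`, this
equates `ρ(hm)` with a twist of `ρ ∘ u`. As `ρ ∘ u` is the test map of `ρ(m)`, that twist is `h² m₀
⊗ h³ m₁ S(h¹)`. -/
lemma coact_algAct (hs : s.IsHexagonal) (hs' : s.IsSymmAtId) (h : H) (m : M.carrier) :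
    M.coact (s.algAct hs hs' h m) = aydAct (s.algAct hs hs') h (M.coact m) := by
  let W := sub _ _ ((regular k H).isSub_cyclic h)
  let p : W ⟶ regular k H := subι _ _ ((regular k H).isSub_cyclic h)
  let w : W.carrier := (⟨h, (regular k H).mem_cyclic h⟩ : (regular k H).cyclic h)
  let u : ((homL W).obj M).carrier := homLOfFinite W M (counitMap p m)
  have h0 : lin (s.swap _ W (ev W M)) =
      swapLin (s.algAct hs hs').toLinearMap _ W (lin (ev W M)) :=
    TensorProduct.ext' fun w t => s.swap_eq _ t w
  have h1 := coact_lin (s.swap _ W (ev W M)) (w ⊗ₜ[k] u)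
  rw [h0] at h1
  have h2 := h1.trans (rTensor_swapLin _ (ev W M) w u)
  have h3 : M.coact ∘ₗ lin (ev W M) ∘ₗ TensorProduct.mk k _ W.carrier u =
    counitMap p (M.coact m) := LinearMap.ext fun w' => map_smul M.coact _ m
  rw [h3, actTwist_counitMap] at h2
  refine Eq.trans ?_ h2
  congr 1
  exact (actTwist_counitMap (s.algAct hs hs').toLinearMap p m w).symm

/-- The anti-Yetter-Drinfeld module given by a symmetric exchange. -/
noncomputable def toAYD (hs : s.IsHexagonal) (hs' : s.IsSymmAtId) : AYDModule k H where
  toComod := M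
  act := s.algAct hs hs'
  ayd := s.coact_algAct hs hs'

lemma isStable_toAYD (hs : s.IsHexagonal) (hs' : s.IsSymmAtId) :
    AYDModule.IsStable (s.toAYD hs hs') :=
  s.stable hs hs'

lemma swap_eq_twist (hs : s.IsHexagonal) (hs' : s.IsSymmAtId) {T W : Comod k H} (f : T ⊗ W ⟶ M)
    (t : T.carrier) (w : W.carrier) : lin (s.swap T W f) (w ⊗ₜ[k] t) =
      (s.toAYD hs hs').twist (W := W) (lin f ∘ₗ TensorProduct.mk k T.carrier W.carrier t) w :=
  s.swap_eq f t w

end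
end Exchange

/-! ### The exchange of a stable anti-Yetter-Drinfeld module -/

namespace Comod

section
variable {k H : Type u} [Field k] [Ring H] [HopfAlgebra k H]

/-- `a((w ⊗ v)₁) g((w ⊗ v)₀) = a(w₁) a(v₁) g(w₀ ⊗ v₀)` -/
lemma actTwist_tensor {M : Type u} [AddCommGroup M] [Module k M] (a : H →ₐ[k] Module.End k M)
    (W V : Comod k H) (g : W.carrier ⊗[k] V.carrier →ₗ[k] M) (w : W.carrier) (v : V.carrier) :
    actTwist a.toLinearMap (W ⊗ V) g (w ⊗ₜ[k] v) =
      actTwist a.toLinearMap W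
        ((actTwist a.toLinearMap V ∘ₗ TensorProduct.curry g).flip v) w := by
  change TensorProduct.lift a.toLinearMap.flip
    (g.rTensor H (Coaction.tensor W.coact V.coact (w ⊗ₜ v))) =
    TensorProduct.lift a.toLinearMap.flip
      (((actTwist a.toLinearMap V ∘ₗ TensorProduct.curry g).flip v).rTensor H (W.coact w))
  rw [Coaction.tensor_tmul]
  generalize W.coact w = s
  induction s with
  | zero => simp
  | add x y hx hy => simp only [map_add, TensorProduct.add_tmul, hx, hy]
  | tmul w x =>
    simp only [LinearMap.rTensor_tmul, LinearMap.flip_apply, LinearMap.comp_apply, actTwist_apply,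
      TensorProduct.lift.tmul]
    generalize V.coact v = r
    induction r with
    | zero => simp
    | add x y hx hy => simp only [map_add, TensorProduct.tmul_add, hx, hy]
    | tmul v y => simp

end
end Comod

namespace AYDModule

open Comod

section
variable {k H : Type u} [Field k] [Ring H] [HopfAlgebra k H]

lemma twist_eq (M : AYDModule k H) {W : Comod k H} (f : W.carrier →ₗ[k] M.carrier) :
    M.twist f = actTwist M.act.toLinearMap W f := rfl

/-- The anti-Yetter–Drinfeld condition says that `ρ : M → M ⊗ H` is linear for the action `aydAct`,
so `ρ` commutes with twisting. -/
lemma coact_twist (M : AYDModule k H) {W : Comod k H} (f : W.carrier →ₗ[k] M.carrier)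
    (w : W.carrier) : M.coact (M.twist f w) = actTwist (aydAct M.act) W (M.coact ∘ₗ f) w :=
  (LinearMap.congr_fun (actTwist_comp M.act.toLinearMap (aydAct M.act) M.coact M.ayd W f) w).symm

/-- `f ↦ (w ⊗ t ↦ w₁ f(t ⊗ w₀))` -/
noncomputable def swap (M : AYDModule k H) (T W : Comod k H) (f : T ⊗ W ⟶ M.toComod) :
    W ⊗ T ⟶ M.toComod :=
  mkHom (M := tensor W T) (swapLin M.act.toLinearMap T W (lin f)) fun (x : W.carrier ⊗[k] T.carrier) => by
    induction x with
    | zero => simp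
    | add x y hx hy => simp only [map_add, hx, hy]
    -- Both coactions give the same twist of `ρ ∘ f(t ⊗ -)`: one by the anti-Yetter–Drinfeld
    -- condition, the other because `f` is a comodule morphism.
    | tmul w t => exact (M.coact_twist _ w).trans (rTensor_swapLin M.act f w t).symm

lemma swap_tmul (M : AYDModule k H) {T W : Comod k H} (f : T ⊗ W ⟶ M.toComod) (t : T.carrier)
    (w : W.carrier) : lin (M.swap T W f) (w ⊗ₜ[k] t) =
      M.twist (lin f ∘ₗ TensorProduct.mk k T.carrier W.carrier t) w := rfl

/-- The exchange `f ↦ (w ⊗ t ↦ w₁ f(t ⊗ w₀))`. -/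
noncomputable def exchange (M : AYDModule k H) : Exchange M.toComod where
  swap := M.swap
  natural a b f := tensor_hom_ext fun w t =>
    LinearMap.congr_fun (actTwist_comp_lin M.act.toLinearMap b
      (lin f ∘ₗ TensorProduct.mk k _ _ (lin a t))) w

/-- The coaction on a tensor product multiplies the components in `H`, so the hexagon is the module
axiom `(v₁ w₁) n = v₁ (w₁ n)`. -/
lemma isHexagonal_exchange (M : AYDModule k H) : M.exchange.IsHexagonal := by
  intro U V W f
  refine hom_ext (TensorProduct.ext_threefold fun v w u => ?_)
  exact actTwist_tensor M.act V W (lin f ∘ₗ TensorProduct.mk k U.carrier _ u) v w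

/-- Two exchanges give `t₁ w₁ f(t₀ ⊗ w₀)`. As `f` is a comodule morphism this is `n₁ n₀` for `n =
f(t ⊗ w)`, hence `n` by stability. -/
lemma swap_swap (M : AYDModule k H) (hM : IsStable M) {T W : Comod k H}
    (f : T ⊗ W ⟶ M.toComod) : M.swap W T (M.swap T W f) = f := by
  refine tensor_hom_ext fun t w => ?_
  have h1 := actTwist_tensor M.act T W (lin f) t w
  refine Eq.trans h1.symm (Eq.trans ?_ (hM _))
  rw [twist_eq, actTwist_apply, actTwist_apply, LinearMap.rTensor_id_apply]
  exact congrArg _ (coact_lin f _).symm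

/-- A comodule morphism that is compatible with the twists of rational maps is `H`-linear. -/
lemma map_act_of_twist {M N : AYDModule k H} (θ : M.toComod ⟶ N.toComod)
    (hθ : ∀ (W : Comod k H) (f : ((homL W).obj M.toComod).carrier),
      N.twist (lin θ ∘ₗ homLVal f) = lin θ ∘ₗ M.twist (homLVal f)) (h : H) (m : M.carrier) :
    lin θ (M.act h m) = N.act h (lin θ m) := by
  let W := sub _ _ ((regular k H).isSub_cyclic h)
  let p : W ⟶ regular k H := subι _ _ ((regular k H).isSub_cyclic h)
  let w : W.carrier := (⟨h, (regular k H).mem_cyclic h⟩ : (regular k H).cyclic h)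
  -- At the test map of `m` and the vector `h`, the two twists are `h θ(m)` and `θ(hm)`.
  have h1 := LinearMap.congr_fun (hθ W (homLOfFinite W M.toComod (counitMap p m))) w
  have h2 : lin θ ∘ₗ counitMap p m = counitMap p (lin θ m) :=
    LinearMap.ext fun w' => map_smul (lin θ) _ m
  rw [homLVal_homLOfFinite, h2, LinearMap.comp_apply, twist_eq, twist_eq, actTwist_counitMap,
    actTwist_counitMap] at h1
  exact h1.symm

lemma Hom.twist_comp {M N : AYDModule k H} (θ : M ⟶ N) {W : Comod k H}
    (f : W.carrier →ₗ[k] M.carrier) : N.twist (lin θ.hom ∘ₗ f) = lin θ.hom ∘ₗ M.twist f :=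
  actTwist_comp _ _ _ θ.map_act W f

lemma Hom.swap_comp {M N : AYDModule k H} (θ : M ⟶ N) {T W : Comod k H}
    (f : T ⊗ W ⟶ M.toComod) : N.swap T W (f ≫ θ.hom) = M.swap T W f ≫ θ.hom :=
  tensor_hom_ext fun w t => LinearMap.congr_fun (Hom.twist_comp θ
    (lin f ∘ₗ TensorProduct.mk k T.carrier W.carrier t)) w

end
end AYDModule

/-! ### The equivalence with the center -/

namespace Comod

section
variable {k H : Type u} [Field k] [Ring H] [HopfAlgebra k H] [BijectiveAntipode k H]
open BiclosedCategory

lemma homRVal_injective {W M : Comod k H} {f g : ((homR W).obj M).carrier}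
    (h : homRVal f = homRVal g) : f = g :=
  Subtype.ext h

lemma hom_actR_ext {T W M : Comod k H} {f g : T ⟶ actR M W}
    (h : ∀ t w, homRVal (lin f t) w = homRVal (lin g t) w) : f = g :=
  hom_ext (LinearMap.ext fun t => homRVal_injective (LinearMap.ext (h t)))

end
end Comod

/-! ### Exchanges and transposition in a biclosed category. -/

namespace BiclosedCategory

section
universe v w
variable {C : Type w} [Category.{v} C] [MonoidalCategory C] [BiclosedCategory C]

lemma curL_symm_comp {T T' W M : C} (f : T' ⟶ T) (g : T ⟶ actL W M) :
    (curL T' W M).symm (f ≫ g) = (f ⊗ₘ 𝟙 W) ≫ (curL T W M).symm g := by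
  rw [tensorHom_id]
  exact (adjL W).homEquiv_naturality_left_symm f g

lemma curR_symm_comp {T T' W M : C} (f : T' ⟶ T) (g : T ⟶ actR M W) :
    (curR T' W M).symm (f ≫ g) = (𝟙 W ⊗ₘ f) ≫ (curR T W M).symm g := by
  rw [id_tensorHom]
  exact (adjR W).homEquiv_naturality_left_symm f g

lemma tensorHom_evL {T W M : C} (g : T ⟶ actL W M) :
    (g ⊗ₘ 𝟙 W) ≫ evL W M = (curL T W M).symm g := by
  rw [evL, ← curL_symm_comp, Category.comp_id]

lemma tensorHom_evR {T W M : C} (g : T ⟶ actR M W) :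
    (𝟙 W ⊗ₘ g) ≫ evR W M = (curR T W M).symm g := by
  rw [evR, ← curR_symm_comp, Category.comp_id]

end
end BiclosedCategory

namespace Exchange

section
universe v w
variable {C : Type w} [Category.{v} C] [MonoidalCategory C] [BiclosedCategory C] {M : C}
  (s : Exchange M)
open BiclosedCategory

/-- The exchange is recovered from the single morphism `W ▷ M → M ◁ W` obtained from evaluation;
this is naturality in `T`. -/
lemma swap_eq_curR_symm {T W : C} (g : T ⟶ actL W M) :
    (curR T W M).symm (g ≫ curR _ W M (s.swap _ W (evL W M))) =
      s.swap T W ((curL T W M).symm g) := by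
  rw [curR_symm_comp, Equiv.symm_apply_apply, ← s.natural, tensorHom_evL]

lemma swap_eq_curL_symm {T W : C} (g : T ⟶ actR M W) :
    (curL T W M).symm (g ≫ curL _ W M (s.swap W _ (evR W M))) =
      s.swap W T ((curR T W M).symm g) := by
  rw [curL_symm_comp, Equiv.symm_apply_apply, ← s.natural, tensorHom_evR]

/-- The isomorphism `W ▷ M ≅ M ◁ W` given by an involutive exchange. -/
def actIso (hs : ∀ T W f, s.swap W T (s.swap T W f) = f) (W : C) : actL W M ≅ actR M W where
  hom := curR _ W M (s.swap _ W (evL W M))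
  inv := curL _ W M (s.swap W _ (evR W M))
  hom_inv_id := by
    -- After transposition the composite is the evaluation exchanged twice.
    apply (curL _ W M).symm.injective
    rw [swap_eq_curL_symm, Equiv.symm_apply_apply, hs, evL]
  inv_hom_id := by
    apply (curR _ W M).symm.injective
    rw [swap_eq_curR_symm, Equiv.symm_apply_apply, hs, evR]

end
end Exchange

/-! ### The exchange of an object of the center. -/

namespace OpCenter

section
universe v w
variable {C : Type w} [Category.{v} C] [MonoidalCategory C] [BiclosedCategory C]
open BiclosedCategory

/-- Isomorphisms in the center from isomorphisms of the underlying objects. -/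
def isoMk {X Y : OpCenter C} (e : X.obj ≅ Y.obj)
    (h : ∀ W : C, (X.τ W).hom ≫ (homR W).map e.hom = (homL W).map e.hom ≫ (Y.τ W).hom) :
    X ≅ Y where
  hom := ⟨e.hom, h⟩
  inv := ⟨e.inv, fun W => by
    have h1 := congrArg (fun g => (homL W).map e.inv ≫ g ≫ (homR W).map e.inv) (h W)
    simpa [← Functor.map_comp, ← Functor.map_comp_assoc] using h1.symm⟩
  hom_inv_id := Hom.ext e.hom_inv_id
  inv_hom_id := Hom.ext e.inv_hom_id

end

open Comod

section
variable {k H : Type u} [Field k] [Ring H] [HopfAlgebra k H] [BijectiveAntipode k H]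
open BiclosedCategory

lemma natural_apply (Z : OpCenter (Comod k H)) {W W' : Comod k H} (φ : W' ⟶ W)
    (g : (actL W Z.obj).carrier) (g' : (actL W' Z.obj).carrier)
    (h : homLVal g' = homLVal g ∘ₗ lin φ) :
    homRVal (lin (Z.τ W').hom g') = homRVal (lin (Z.τ W).hom g) ∘ₗ lin φ := by
  have h1 : g' = lin (preL φ Z.obj) g := homLVal_injective h
  have h2 := congrArg (fun f => homRVal (lin f g)) (Z.natural φ)
  rw [h1]
  exact h2.symm

/-- The exchange that corresponds to a central structure under
`Hom(T ⊗ W, M) ≃ Hom(T, W ▷ M) ≃ Hom(T, M ◁ W) ≃ Hom(W ⊗ T, M)`. -/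
noncomputable def exchange (Z : OpCenter (Comod k H)) : Exchange Z.obj where
  swap T W f := (curR T W Z.obj).symm (curL T W Z.obj f ≫ (Z.τ W).hom)
  natural {T T' W W'} a b f := tensor_hom_ext fun w t =>
    LinearMap.congr_fun (Z.natural_apply b (lin (curL T W Z.obj f) (lin a t))
      (lin (curL T' W' Z.obj ((a ⊗ₘ b) ≫ f)) t) rfl) w

lemma exchange_tmul (Z : OpCenter (Comod k H)) {T W : Comod k H} (f : T ⊗ W ⟶ Z.obj)
    (t : T.carrier) (w : W.carrier) : lin (Z.exchange.swap T W f) (w ⊗ₜ[k] t) =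
      homRVal (lin (Z.τ W).hom (lin (curL T W Z.obj f) t)) w := rfl

/-- The axiom for `τ_{W ⊗ V}` read on elements: `τ_V` is applied to `g(w' ⊗ -)` and evaluated at
`v`, and `τ_W` is applied to the resulting map in `w'`. Taking `y` as an element of `W ▷ M` with
these values separates the computation from the question of rationality. -/
lemma assoc_apply (Z : OpCenter (Comod k H)) (W V : Comod k H)
    (g : (actL (W ⊗ V) Z.obj).carrier) (w : W.carrier) (v : V.carrier)
    (y : (actL W Z.obj).carrier)
    (hy : ∀ w', homLVal y w' =
      homRVal (lin (Z.τ V).hom (homLVal (lin (assocL W V Z.obj) g) w')) v) :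
    homRVal (lin (Z.τ (W ⊗ V)).hom g) (w ⊗ₜ[k] v) = homRVal (lin (Z.τ W).hom y) w := by
  have h1 : y = homRVal (lin (assocL W V Z.obj ≫ (BiclosedCategory.homL W).map (Z.τ V).hom ≫
      assocM W V Z.obj) g) v := homLVal_injective (LinearMap.ext hy)
  rw [h1, Z.assoc W V]
  rfl

/-- The intermediate map `y` required by `assoc_apply` is the transpose of the map obtained by
exchanging the second factor alone. -/
lemma isHexagonal_exchange (Z : OpCenter (Comod k H)) : Z.exchange.IsHexagonal := by
  intro U V W f
  refine hom_ext (TensorProduct.ext_threefold fun v w u => ?_)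
  refine Z.assoc_apply V W (lin (curL U (V ⊗ W) Z.obj f) u) v w
    (lin (curL (W ⊗ U) V Z.obj ((α_ W U V).hom ≫ Z.exchange.swap (U ⊗ V) W
      ((α_ U V W).hom ≫ f))) (w ⊗ₜ[k] u)) fun v' => ?_
  exact congrArg (fun g => homRVal (lin (Z.τ W).hom g) w)
    (homLVal_injective (LinearMap.ext fun w' => rfl))

/-- The two halves come from different axioms: the unit condition on `τ` sends the right unitor to
the left one, and the condition on `Id_M` sends it back. -/
lemma isSymmAtId_exchange (Z : OpCenter (Comod k H)) (hZ : FixesId Z) :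
    Z.exchange.IsSymmAtId := by
  have h1 : Z.exchange.swap Z.obj (𝟙_ _) (ρ_ Z.obj).hom = (λ_ Z.obj).hom :=
    ((curR _ _ _).symm_apply_eq).2 Z.unit
  have h2 : Z.exchange.swap (𝟙_ _) Z.obj (λ_ Z.obj).hom = (ρ_ Z.obj).hom := by
    have h3 : (ρ_ Z.obj).inv ≫ Z.exchange.swap (𝟙_ _) Z.obj ((λ_ Z.obj).hom ≫ 𝟙 _) = 𝟙 _ := hZ
    rw [Category.comp_id, Iso.inv_comp_eq, Category.comp_id] at h3
    exact h3
  rw [Exchange.IsSymmAtId, h1, h2]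

/-- This is the classification of exchanges applied to the evaluation, whose transpose is the
identity of `W ▷ M`. -/
lemma τ_apply (Z : OpCenter (Comod k H)) (hZ : FixesId Z) (W : Comod k H)
    (f : (actL W Z.obj).carrier) : homRVal (lin (Z.τ W).hom f) =
      (Z.exchange.toAYD Z.isHexagonal_exchange (Z.isSymmAtId_exchange hZ)).twist
        (W := W) (homLVal f) := by
  ext w
  have h := Z.exchange.swap_eq_twist Z.isHexagonal_exchange (Z.isSymmAtId_exchange hZ)
    (evL W Z.obj) f w
  refine Eq.trans ?_ h
  rw [exchange_tmul]
  exact congrArg (fun g => homRVal (lin (Z.τ W).hom g) w)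
    (homLVal_injective (LinearMap.ext fun w' => rfl))

end
end OpCenter

/-! ### The central structure of a stable anti-Yetter–Drinfeld module. -/

namespace SAYDModule

open Comod BiclosedCategory

section
variable {k H : Type u} [Field k] [Ring H] [HopfAlgebra k H] [BijectiveAntipode k H]

/-- `τ_W f(w) = w₁ f(w₀)` as an isomorphism of comodules. -/
noncomputable def τ (M : SAYDModule k H) (W : Comod k H) :
    actL W M.obj.toComod ≅ actR M.obj.toComod W :=
  M.obj.exchange.actIso (fun _ _ f => M.obj.swap_swap M.property f) W

lemma τ_apply (M : SAYDModule k H) (W : Comod k H) (f : (actL W M.obj.toComod).carrier) :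
    homRVal (lin (M.τ W).hom f) = M.obj.twist (homLVal f) := rfl

/-- The object of the center given by a stable anti-Yetter-Drinfeld module. -/
noncomputable def toOpCenter (M : SAYDModule k H) : OpCenter (Comod k H) where
  obj := M.obj.toComod
  τ := M.τ
  natural φ := hom_actR_ext fun f w =>
    (LinearMap.congr_fun (actTwist_comp_lin M.obj.act.toLinearMap φ (homLVal f)) w).symm
  -- On elements the composite of the associators and the two twists is `w₁ v₁ f(w₀ ⊗ v₀)`, so only
  -- the module axiom is needed.
  assoc W V := hom_ext (LinearMap.ext fun f => homRVal_injective
    (TensorProduct.ext' fun w v => actTwist_tensor M.obj.act W V (homLVal f) w v))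
  unit := hom_actR_ext fun m c => by
    refine (LinearMap.congr_fun (Exchange.actTwist_unit M.obj.act.toLinearMap
      (homLVal (lin (unitL M.obj.toComod) m))) c).trans ?_
    simp only [AlgHom.toLinearMap_apply, map_one]
    rfl

/-- Up to unitors, the image of the identity is the exchange of `k ⊗ M ≅ M`, which is `m ⊗ c ↦ c m₁
m₀`; stability makes it the identity. -/
lemma fixesId_toOpCenter (M : SAYDModule k H) : OpCenter.FixesId M.toOpCenter := by
  have h1 := M.obj.exchange.swap_eq_curR_symm (curL _ _ _ ((λ_ M.obj.toComod).hom ≫ 𝟙 _))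
  rw [Equiv.symm_apply_apply] at h1
  have h2 : M.obj.swap _ _ ((λ_ M.obj.toComod).hom ≫ 𝟙 _) = (ρ_ M.obj.toComod).hom := by
    refine tensor_hom_ext fun m (c : k) => ?_
    rw [AYDModule.swap_tmul]
    have h3 : lin ((λ_ M.obj.toComod).hom ≫ 𝟙 _) ∘ₗ
        TensorProduct.mk k (𝟙_ (Comod k H)).carrier M.obj.carrier c = c • LinearMap.id :=
      LinearMap.ext fun _ => rfl
    rw [h3, AYDModule.twist_eq, map_smul, LinearMap.smul_apply, ← AYDModule.twist_eq,
      M.property]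
    rfl
  change (ρ_ M.obj.toComod).inv ≫ (curR _ _ _).symm (curL _ _ _ ((λ_ M.obj.toComod).hom ≫ 𝟙 _) ≫
    curR _ _ _ (M.obj.exchange.swap _ _ (evL _ _))) = 𝟙 _
  rw [h1]
  change (ρ_ M.obj.toComod).inv ≫ M.obj.swap _ _ _ = 𝟙 _
  rw [h2, Iso.inv_hom_id]

/-- The functor from stable anti-Yetter-Drinfeld modules to the center. -/
noncomputable def centerFunctor (k H : Type u) [Field k] [Ring H] [HopfAlgebra k H]
    [BijectiveAntipode k H] : SAYDModule k H ⥤ StableOpCenter (Comod k H) where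
  obj M := ⟨M.toOpCenter, M.fixesId_toOpCenter⟩
  map {M N} θ := ObjectProperty.homMk ⟨θ.hom.hom, fun W => hom_actR_ext fun f w =>
    (LinearMap.congr_fun (AYDModule.Hom.twist_comp θ.hom (homLVal f)) w).symm⟩

instance : (centerFunctor k H).Faithful where
  map_injective {_ _} f g h := by
    have h1 := congrArg (fun x => x.hom.hom) h
    exact ObjectProperty.hom_ext _ (AYDModule.Hom.ext h1)

/-- Commuting with all `τ_W` is compatibility with the twists of rational maps, and test maps on
finite-dimensional subcomodules of `H` turn this into `H`-linearity. -/
instance : (centerFunctor k H).Full where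
  map_surjective {_ _} θ := ⟨ObjectProperty.homMk ⟨θ.hom.hom,
    AYDModule.map_act_of_twist θ.hom.hom fun W f =>
      (congrArg (fun g => homRVal (lin g f)) (θ.hom.comm W)).symm⟩, rfl⟩

/-- The preimage has the same comodule, with the action recovered from the exchange; as `τ` is
already given by the twist, the identity map is an isomorphism in the center. -/
instance : (centerFunctor k H).EssSurj where
  mem_essImage Z := by
    let s := Z.obj.exchange
    have hs := Z.obj.isHexagonal_exchange
    have hs' := Z.obj.isSymmAtId_exchange Z.property
    refine ⟨⟨s.toAYD hs hs', s.isStable_toAYD hs hs'⟩, ⟨ObjectProperty.isoMk _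
      (OpCenter.isoMk (Iso.refl _) fun W => ?_)⟩⟩
    exact hom_actR_ext fun f w =>
      (LinearMap.congr_fun (Z.obj.τ_apply Z.property W f) w).symm

instance : (centerFunctor k H).IsEquivalence where

end
end SAYDModule

/-! ### The equivalence with the representable contratraces -/

namespace SymmContratrace

section
universe w
variable {k : Type*} [Field k] {C : Type w} [Category.{u} C] [MonoidalCategory C]
open Opposite

/-- Isomorphisms of contratraces from natural isomorphisms. -/
def isoMk {F G : SymmContratrace k C} (e : F.F ≅ G.F)
    (h : ∀ V W : C, (F.ι V W).hom ≫ e.hom.app (op (W ⊗ V)) =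
      e.hom.app (op (V ⊗ W)) ≫ (G.ι V W).hom) : F ≅ G where
  hom := ⟨e.hom, h⟩
  inv := ⟨e.inv, fun V W => by
    rw [← cancel_epi (e.hom.app (op (V ⊗ W))), ← reassoc_of% h, Iso.hom_inv_id_app,
      Iso.hom_inv_id_app_assoc, Category.comp_id]⟩
  hom_inv_id := Hom.ext e.hom_inv_id
  inv_hom_id := Hom.ext e.inv_hom_id

/-- A contratrace transported along an isomorphism of functors. -/
def transport (F : SymmContratrace k C) {G : Cᵒᵖ ⥤ ModuleCat.{u} k} (e : F.F ≅ G) :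
    SymmContratrace k C where
  F := G
  ι V W := e.symm.app _ ≪≫ F.ι V W ≪≫ e.app _
  natural f g := by
    simp only [Iso.trans_hom, Iso.app_hom, Iso.symm_hom, Category.assoc]
    rw [← e.hom.naturality, reassoc_of% F.natural f g, e.inv.naturality_assoc]
  hexagon U V W := by
    simp only [Iso.trans_hom, Iso.app_hom, Iso.symm_hom, Category.assoc, F.hexagon]
    simp
  symm V W := by
    simp only [Iso.trans_hom, Iso.app_hom, Iso.symm_hom, Category.assoc,
      Iso.hom_inv_id_app_assoc, reassoc_of% F.symm V W, Iso.inv_hom_id_app]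

/-- A contratrace is isomorphic to its transports. -/
def isoTransport (F : SymmContratrace k C) {G : Cᵒᵖ ⥤ ModuleCat.{u} k} (e : F.F ≅ G) :
    F.transport e ≅ F :=
  isoMk (F := F.transport e) e.symm fun V W => by simp [transport]

/-- The exchange given by a contratrace that is represented by `M`. -/
def exchange [Preadditive C] [Linear k C] (F : SymmContratrace k C) {M : C}
    (e : F.F ≅ (linearYoneda k C).obj M) : Exchange M where
  swap T W f := ((F.transport e).ι T W).hom.hom f
  natural a b f := (LinearMap.congr_fun
    (congrArg ModuleCat.Hom.hom ((F.transport e).natural a b)) f).symm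

lemma isHexagonal_exchange [Preadditive C] [Linear k C] (F : SymmContratrace k C) {M : C}
    (e : F.F ≅ (linearYoneda k C).obj M) : (F.exchange e).IsHexagonal := fun U V W f =>
  LinearMap.congr_fun (congrArg ModuleCat.Hom.hom ((F.transport e).hexagon U V W)) f

/-- Symmetry of `ι` is needed only at the pair `(M, 1)`, applied to the right unitor of `M`. -/
lemma isSymmAtId_exchange [Preadditive C] [Linear k C] (F : SymmContratrace k C) {M : C}
    (e : F.F ≅ (linearYoneda k C).obj M) : (F.exchange e).IsSymmAtId :=
  LinearMap.congr_fun (congrArg ModuleCat.Hom.hom ((F.transport e).symm M (𝟙_ C))) (ρ_ M).hom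

end
end SymmContratrace

namespace SAYDModule

open Comod Opposite

section
variable {k H : Type u} [Field k] [Ring H] [HopfAlgebra k H]

/-- `ι f(w ⊗ v) = w₁ f(v ⊗ w₀)` -/
noncomputable def swapEquiv (M : SAYDModule k H) (V W : Comod k H) :
    (V ⊗ W ⟶ M.obj.toComod) ≃ₗ[k] (W ⊗ V ⟶ M.obj.toComod) where
  toFun := M.obj.swap V W
  map_add' f g := tensor_hom_ext fun w v =>
    LinearMap.congr_fun (map_add (actTwist M.obj.act.toLinearMap W)
      (lin f ∘ₗ TensorProduct.mk k V.carrier W.carrier v)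
      (lin g ∘ₗ TensorProduct.mk k V.carrier W.carrier v)) w
  map_smul' c f := tensor_hom_ext fun w v =>
    LinearMap.congr_fun (map_smul (actTwist M.obj.act.toLinearMap W) c
      (lin f ∘ₗ TensorProduct.mk k V.carrier W.carrier v)) w
  invFun := M.obj.swap W V
  left_inv := M.obj.swap_swap M.property
  right_inv := M.obj.swap_swap M.property

/-- The contratrace `Hom(-, M)` of a stable anti-Yetter-Drinfeld module. -/
noncomputable def toContratrace (M : SAYDModule k H) : SymmContratrace k (Comod k H) where
  F := (linearYoneda k (Comod k H)).obj M.obj.toComod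
  ι V W := (M.swapEquiv V W).toModuleIso
  natural f g := ModuleCat.hom_ext (LinearMap.ext fun x => (M.obj.exchange.natural f g x).symm)
  hexagon U V W := ModuleCat.hom_ext (LinearMap.ext fun x =>
    M.obj.isHexagonal_exchange U V W x)
  symm _ _ := ModuleCat.hom_ext (LinearMap.ext fun x => M.obj.swap_swap M.property x)

/-- The functor from stable anti-Yetter-Drinfeld modules to representable contratraces. -/
noncomputable def contratraceFunctor (k H : Type u) [Field k] [Ring H] [HopfAlgebra k H] :
    SAYDModule k H ⥤ RepContratrace k (Comod k H) where
  obj M := ⟨M.toContratrace, M.obj.toComod, ⟨Iso.refl _⟩⟩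
  map θ := ObjectProperty.homMk ⟨(linearYoneda k (Comod k H)).map θ.hom.hom, fun _ _ =>
    ModuleCat.hom_ext (LinearMap.ext fun x => (AYDModule.Hom.swap_comp θ.hom x).symm)⟩
  map_id _ := ObjectProperty.hom_ext _ (SymmContratrace.Hom.ext ((linearYoneda k (Comod k H)).map_id _))
  map_comp _ _ := ObjectProperty.hom_ext _ (SymmContratrace.Hom.ext ((linearYoneda k (Comod k H)).map_comp _ _))

instance : (contratraceFunctor k H).Faithful where
  map_injective {_ _} f g h := by
    have h1 := congrArg (fun x => x.hom.nat) h
    exact ObjectProperty.hom_ext _ (AYDModule.Hom.ext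
      ((linearYoneda k (Comod k H)).map_injective h1))

/-- Yoneda gives the underlying comodule morphism. Commuting with `ι` on the evaluation `Homˡ(W, M)
⊗ W → M` is compatibility with the twists of rational maps, hence `H`-linearity. -/
instance : (contratraceFunctor k H).Full where
  map_surjective {M N} θ := by
    obtain ⟨f, hf⟩ := (linearYoneda k (Comod k H)).map_surjective
      (X := M.obj.toComod) (Y := N.obj.toComod) θ.hom.nat
    have h1 : ∀ (T W : Comod k H) (x : T ⊗ W ⟶ M.obj.toComod),
        M.obj.swap T W x ≫ f = N.obj.swap T W (x ≫ f) := by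
      intro T W x
      have h2 := θ.hom.comm T W
      rw [← hf] at h2
      exact LinearMap.congr_fun (congrArg ModuleCat.Hom.hom h2) x
    refine ⟨ObjectProperty.homMk ⟨f, AYDModule.map_act_of_twist f fun W g => ?_⟩,
      ObjectProperty.hom_ext _ (SymmContratrace.Hom.ext hf)⟩
    ext w
    exact (congrArg (fun x => lin x (w ⊗ₜ[k] g)) (h1 _ W (ev W M.obj.toComod))).symm

/-- Transport along the representing isomorphism makes the functor equal to `Hom(-, M)`. The
symmetry is then an exchange, and the module recovered from it induces the same symmetry. -/
instance : (contratraceFunctor k H).EssSurj where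
  mem_essImage F := by
    obtain ⟨M, ⟨e⟩⟩ := F.property
    let s := F.obj.exchange e
    have hs := F.obj.isHexagonal_exchange e
    have hs' := F.obj.isSymmAtId_exchange e
    refine ⟨⟨s.toAYD hs hs', s.isStable_toAYD hs hs'⟩, ⟨ObjectProperty.isoMk _
      (SymmContratrace.isoMk (G := F.obj.transport e) (Iso.refl _) (fun V W => ?_) ≪≫
        F.obj.isoTransport e)⟩⟩
    refine ModuleCat.hom_ext (LinearMap.ext fun x => tensor_hom_ext fun w v => ?_)
    exact (s.swap_eq_twist hs hs' x v w).symm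

instance : (contratraceFunctor k H).IsEquivalence where

end
end SAYDModule

theorem mainTheorem2 (k H : Type u) [Field k] [CharZero k] [Ring H] [HopfAlgebra k H]
    [BijectiveAntipode k H] :
    (∃ (E : SAYDModule k H ≌ StableOpCenter (Comod k H))
      (φ : E.functor ⋙ OpCenter.FixesId.ι ⋙ OpCenter.forget (Comod k H) ≅ SAYDModule.forget k H),
      ∀ (M : SAYDModule k H) (W : Comod k H)
        (f : (BiclosedCategory.actL W (E.functor.obj M).obj.obj).carrier),
        Comod.lin (φ.hom.app M) ∘ₗ
            Comod.homRVal (Comod.lin ((E.functor.obj M).obj.τ W).hom f) =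
          M.obj.twist (Comod.lin (φ.hom.app M) ∘ₗ Comod.homLVal f)) ∧
    (∃ (E : SAYDModule k H ≌ RepContratrace k (Comod k H))
      (ψ : E.functor ⋙ SymmContratrace.Representable.ι ⋙ SymmContratrace.forget k (Comod k H) ≅
        SAYDModule.forget k H ⋙ linearYoneda k (Comod k H)),
      ∀ (M : SAYDModule k H) (V W : Comod k H)
        (x : (E.functor.obj M).obj.F.obj (Opposite.op (V ⊗ W))) (v : V.carrier) (w : W.carrier),
        Comod.lin ((ψ.hom.app M).app _ (((E.functor.obj M).obj.ι V W).hom x)) (w ⊗ₜ[k] v) =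
          M.obj.twist (W := W) (Comod.lin ((ψ.hom.app M).app _ x) ∘ₗ
            TensorProduct.mk k V.carrier W.carrier v) w) := by
  -- Both functors keep the comodule, or the functor it represents, so the comparison isomorphisms
  -- are identities and the two formulas are the definitions of `τ` and `ι`.
  refine ⟨⟨(SAYDModule.centerFunctor k H).asEquivalence, Iso.refl _, fun M W f => ?_⟩,
    ⟨(SAYDModule.contratraceFunctor k H).asEquivalence, Iso.refl _, fun M V W x v w => ?_⟩⟩
  · exact M.τ_apply W f
  · exact M.obj.swap_tmul x v w
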